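/- **Lemma 1.3 (Kenig–Ponce–Vega refined Strichartz inequality).** For $u\in L^2(\mathbb R;\mathbb C)$ let $\widehat u(\xi)=\int_{\mathbb R} e^{-ix\xi}u(x)\,dx$ denote the Fourier transform (extended to $L^2$ by Plancherel). Let $e^{-t\partial_x^3}$, $t\in\mathbb R$, be the Airy evolution operator, $\big(e^{-t\partial_x^3}u\big)^{\wedge}(\xi)=e^{it\xi^3}\widehat u(\xi)$, and let $D^{1/6}$ be the fractional differentiation operator, $(D^{1/6}f)^{\wedge}(\xi)=|\xi|^{1/6}\widehat f(\xi)$, where for $f\in L^2(\mathbb R)$ the object $D^{1/6}f$ is a tempered distribution on $\mathbb R$. Let $1<p<\infty$. There is a constant $C<\infty$, depending only on $p$, such that for every $u_0\in L^2(\mathbb R;\mathbb C)$ there is a measurable function $w:\mathbb R\times\mathbb R\to\mathbb C$ such that for almost every $t$ the distribution $D^{1/6}e^{-t\partial_x^3}u_0$ is the function $w(t,\cdot)$, and $$\big\|D^{1/6}e^{-t\partial_x^3}u_0\big\|_{L^6_{t,x}(\mathbb R\times\mathbb R)}=\|w\|_{L^6(\mathbb R\times\mathbb R)}\le C\Big(\sup_{\tau}|\tau|^{\frac12-\frac1p}\,\|\widehat{u_0}\|_{L^p(\tau)}\Big)^{1/3}\,\|u_0\|_{L^2(\mathbb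 R)}^{2/3},$$ where the supremum, taken in $[0,\infty]$, runs over all bounded intervals $\tau\subset\mathbb R$ of positive length $|\tau|$. -/

import Mathlib

open MeasureTheory
open scoped FourierTransform SchwartzMap ENNReal NNReal

noncomputable section

namespace Airy

/-- The complex Hilbert space of square integrable functions on the real line (modulo null sets). -/
abbrev L2 : Type := Lp ℂ 2 (volume : Measure ℝ)

/-- The Fourier transform of `u ∈ L²`, normalised as `û(ξ) = ∫ e^{-i x ξ} u(x) dx` (extended from
integrable functions to `L²` by Plancherel). Mathlib's `𝓕` is normalised with `e^{-2 π i x ξ}`,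
hence the rescaling of the frequency variable. -/
def hat (u : L2) : ℝ → ℂ := fun ξ => (𝓕 u : L2) (ξ / (2 * Real.pi))

/-- The same normalisation of the Fourier transform on Schwartz functions:
`φ̂(x) = ∫ e^{-i x ξ} φ(ξ) dξ`. -/
def schwartzHat (φ : 𝓢(ℝ, ℂ)) : ℝ → ℂ :=
  fun x => ∫ ξ : ℝ, Complex.exp (-(Complex.I * x * ξ)) * φ ξ

/-- The symbol `e^{i t ξ³}` of `e^{-t ∂ₓ³}`, in the frequency variable `ξ` of `hat`. -/
def symbol (t ξ : ℝ) : ℂ := Complex.exp (Complex.I * t * (ξ : ℂ) ^ 3)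

theorem norm_symbol (t ξ : ℝ) : ‖symbol t ξ‖ = 1 := by
  have h : Complex.I * t * (ξ : ℂ) ^ 3 = ((t * ξ ^ 3 : ℝ) : ℂ) * Complex.I := by
    push_cast; ring
  rw [symbol, h, Complex.norm_exp_ofReal_mul_I]

/-- Multiplication by the (rescaled) Airy symbol preserves `L²`. -/
theorem memLp_symbol_mul (t : ℝ) (v : L2) :
    MemLp (fun η : ℝ => symbol t (2 * Real.pi * η) * v η) 2 volume := by
  have hc : Continuous (fun η : ℝ => symbol t (2 * Real.pi * η)) := by
    unfold symbol; fun_prop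
  refine (memLp_congr_norm (hc.aestronglyMeasurable.mul (Lp.aestronglyMeasurable v))
    (Lp.aestronglyMeasurable v) ?_).2 (Lp.memLp v)
  filter_upwards with η
  rw [Pi.mul_apply, norm_mul, norm_symbol, one_mul]

/-- The Airy evolution operator `e^{-t ∂ₓ³}` on `L²`: the Fourier multiplier with
`(e^{-t ∂ₓ³} u)^(ξ) = e^{i t ξ³} û(ξ)`. -/
def evolution (t : ℝ) (u : L2) : L2 :=
  𝓕⁻ ((memLp_symbol_mul t (𝓕 u)).toLp _ : L2)

/-- The tempered distribution `D^α f` (for `f ∈ L²` and `α ≥ 0`) is the function `g`. That is, `g`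
integrates against all Schwartz functions, and its Fourier transform `ĝ`, taken in the sense of
tempered distributions (`⟨ĝ, φ⟩ = ⟨g, φ̂⟩`), is the function `|ξ|^α f̂(ξ)`. -/
def IsFracDeriv (α : ℝ) (f : L2) (g : ℝ → ℂ) : Prop :=
  ∀ φ : 𝓢(ℝ, ℂ),
    Integrable (fun x : ℝ => g x * schwartzHat φ x) ∧
    ∫ x : ℝ, g x * schwartzHat φ x = ∫ ξ : ℝ, ((|ξ| ^ α : ℝ) : ℂ) * hat f ξ * φ ξ

/-- The quantity `sup_τ |τ|^{1/2 - 1/p} ‖û‖_{L^p(τ)} ∈ [0, ∞]`, the supremum being over all bounded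
nondegenerate intervals `τ` of the real line. (Including or excluding end points does not change
the norms.) -/
def intervalSup (p : ℝ) (u : L2) : ℝ≥0∞ :=
  ⨆ (a : ℝ) (b : ℝ) (_ : a < b),
    ENNReal.ofReal ((b - a) ^ (1 / 2 - 1 / p : ℝ)) *
      eLpNorm (hat u) (ENNReal.ofReal p) (volume.restrict (Set.Icc a b))

end Airy

end

/-!
The whole estimate is bilinear. For `v = û` put `h(ξ) = |ξ|^{1/6} v(ξ)`. The square of
`w(t, x) = (2π)⁻¹ ∫ e^{i (t ξ³ + x ξ)} h(ξ) dξ` is an integral over pairs of frequencies `(ξ, η)`, in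
which the map `(ξ, η) ↦ (ξ³ + η³, ξ + η)` is injective on the half plane `ξ < η` (off `ξ + η = 0`)
and has Jacobian `3 |ξ² - η²|`. After this change of variables `w²` is a Fourier transform in the
plane, and the Hausdorff–Young inequality `L^{3/2} → L³` gives (`lintegral_enorm_wave_pow_six_le`)

  `‖w‖₆⁶ ≤ C (∬ |v(ξ)|^{3/2} |v(η)|^{3/2} ||ξ| - |η||^{-1/2} dξ dη)²`,

because the weight `|ξ η|^{1/4}` is absorbed by the factor `(|ξ| + |η|)^{-1/2}` of the Jacobian.

It remains to bound the double integral by `C S ‖v‖₂²`, `S` being the supremum over intervals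
(`lintegral_lintegral_rieszKernel_le`). Since the supremum increases with the exponent, `p ≤ 3/2` may
be assumed. By symmetry only `|v(η)| ≤ |v(ξ)| = M` matters. For fixed `ξ`, the part of the inner
integral within the distance `(S / M)²` of `±ξ` is estimated by `|v(η)| ≤ M`; on the rest
`|v(η)|^{3/2} ≤ M^{3/2 - p} |v(η)|^p`, and the dyadic shells around `±ξ` form a convergent geometric
series precisely because `p > 1`. Both parts are at most a multiple of `S M^{1/2}`.

For general `u₀ ∈ L²` the frequencies are cut off at `|ξ| ≤ n`. As `S ≤ ‖v‖₂` for `p ≤ 2`, the estimate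
itself shows that the resulting functions are Cauchy in `L⁶(ℝ × ℝ)`. Their limit is the required
`w`: along a subsequence almost every time slice converges in `L⁶(ℝ)`, so the identity that defines
the fractional derivative passes to the limit against Schwartz functions.
-/

namespace Airy

/-! ### Plancherel and Hausdorff–Young for the Fourier integral -/

section FourierIntegral

variable {V : Type*} [NormedAddCommGroup V] [InnerProductSpace ℝ V] [FiniteDimensional ℝ V]
  [MeasurableSpace V] [BorelSpace V]

theorem continuous_fourier_of_integrable {f : V → ℂ} (hf : Integrable f) : Continuous (𝓕 f) :=
  VectorFourier.fourierIntegral_continuous Real.continuous_fourierChar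
    (by exact continuous_inner) hf

theorem integral_fourier_mul_eq {f g : V → ℂ} (hf : Integrable f) (hg : Integrable g) :
    ∫ y, 𝓕 f y * g y = ∫ x, f x * 𝓕 g x := by
  have h := VectorFourier.integral_fourierIntegral_smul_eq_flip (μ := (volume : Measure V))
    (ν := (volume : Measure V)) (L := innerₗ V) Real.continuous_fourierChar continuous_inner hf hg
  rw [flip_innerₗ] at h
  exact h

/-- On `L¹ ∩ L²` the Plancherel extension of the Fourier transform is the Fourier integral. -/
theorem fourier_toLp_ae_eq {f : V → ℂ} (h1 : Integrable f) (h2 : MemLp f 2) :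
    ((𝓕 (h2.toLp f) : Lp ℂ 2 (volume : Measure V)) : V → ℂ) =ᵐ[volume] 𝓕 f := by
  refine ae_eq_of_integral_contDiff_smul_eq ((Lp.memLp _).locallyIntegrable (by norm_num))
    (continuous_fourier_of_integrable h1).locallyIntegrable fun g hg hgc => ?_
  have hg' : ContDiff ℝ (⊤ : ℕ∞) (fun x => (g x : ℂ)) := Complex.ofRealCLM.contDiff.comp hg
  have hgc' : HasCompactSupport (fun x => (g x : ℂ)) := hgc.comp_left (g := Complex.ofReal) rfl
  set φ : 𝓢(V, ℂ) := hgc'.toSchwartzMap hg' with hφ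
  have hφx : ∀ x, φ x = (g x : ℂ) := fun x => rfl
  have e1 : ∫ x, φ x • (𝓕 (h2.toLp f) : Lp ℂ 2 (volume : Measure V)) x =
      ∫ x, (𝓕 φ) x • (h2.toLp f) x := by
    rw [← Lp.toTemperedDistribution_apply, ← Lp.fourier_toTemperedDistribution_eq,
      ← Lp.toTemperedDistribution_apply]
    rfl
  have e2 : ∫ x, (𝓕 φ) x • (h2.toLp f) x = ∫ x, f x * 𝓕 (φ : V → ℂ) x := by
    refine integral_congr_ae ?_
    filter_upwards [h2.coeFn_toLp] with x hx
    rw [hx, SchwartzMap.fourier_coe, smul_eq_mul, mul_comm]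
  rw [← integral_fourier_mul_eq h1 φ.integrable] at e2
  calc ∫ x, g x • (𝓕 (h2.toLp f) : Lp ℂ 2 (volume : Measure V)) x
      = ∫ x, φ x • (𝓕 (h2.toLp f) : Lp ℂ 2 (volume : Measure V)) x := by
        simp only [hφx, smul_eq_mul, Complex.real_smul]
    _ = ∫ x, 𝓕 f x * φ x := by rw [e1, e2]
    _ = ∫ x, g x • 𝓕 f x := by simp only [hφx, Complex.real_smul, mul_comm]

/-- Plancherel's identity for the Fourier integral on `L¹ ∩ L²`. -/
theorem lintegral_enorm_fourier_sq {f : V → ℂ} (h1 : Integrable f) (h2 : MemLp f 2) :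
    ∫⁻ y, ‖𝓕 f y‖ₑ ^ (2 : ℝ) = ∫⁻ x, ‖f x‖ₑ ^ (2 : ℝ) := by
  have h : eLpNorm (𝓕 f) 2 volume = eLpNorm f 2 volume := by
    rw [← eLpNorm_congr_ae (fourier_toLp_ae_eq h1 h2), ← eLpNorm_congr_ae h2.coeFn_toLp,
      ← Lp.enorm_def, ← Lp.enorm_def, ← ofReal_norm, ← ofReal_norm, Lp.norm_fourier_eq]
  rw [eLpNorm_eq_lintegral_rpow_enorm_toReal (by norm_num) (by norm_num),
    eLpNorm_eq_lintegral_rpow_enorm_toReal (by norm_num) (by norm_num)] at h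
  exact ENNReal.rpow_left_injective (by norm_num) h

theorem norm_fourier_le (f : V → ℂ) (y : V) : ‖𝓕 f y‖ ≤ ∫ x, ‖f x‖ :=
  VectorFourier.norm_fourierIntegral_le_integral_norm _ _ _ f y

/-- The bound for the distribution function of `𝓕 f` from splitting `f` at the height
`4 a² / l²`, where `a = ∫ ‖f‖ ^ (3/2)`: the high part has small `L¹` norm and so cannot push `𝓕 f`
above `l / 2`, and the low part is estimated by Plancherel and Chebyshev. -/
theorem measure_lt_norm_fourier_mul_sq_le {f : V → ℂ} (hf : Integrable f) (hfm : StronglyMeasurable f)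
    {a : ℝ} (ha : 0 < a) (hfa : ∫⁻ x, ‖f x‖ₑ ^ (3 / 2 : ℝ) = ENNReal.ofReal a) {l : ℝ}
    (hl : 0 < l) :
    volume {y | l < ‖𝓕 f y‖} * ENNReal.ofReal (l ^ 2) ≤
      4 * ∫⁻ x, {x | ‖f x‖ * l ^ 2 ≤ 4 * a ^ 2}.indicator (fun x => ‖f x‖ₑ ^ (2 : ℝ)) x := by
  set E : Set V := {x | ‖f x‖ * l ^ 2 ≤ 4 * a ^ 2} with hE
  have hEm : MeasurableSet E :=
    measurableSet_le (hfm.measurable.norm.mul_const _) measurable_const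
  have hlow : Integrable (E.indicator f) := hf.indicator hEm
  have hhigh : Integrable (Eᶜ.indicator f) := hf.indicator hEm.compl
  have hlow2 : MemLp (E.indicator f) 2 := by
    rw [memLp_two_iff_integrable_sq_norm hlow.1]
    refine (hlow.norm.const_mul (4 * a ^ 2 / l ^ 2)).mono' (hlow.1.norm.pow 2) ?_
    refine Filter.Eventually.of_forall fun x => ?_
    rw [Real.norm_of_nonneg (by positivity), pow_two]
    refine mul_le_mul_of_nonneg_right ?_ (norm_nonneg _)
    by_cases hx : x ∈ E
    · rw [Set.indicator_of_mem hx, le_div_iff₀ (by positivity)]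
      exact hx
    · rw [Set.indicator_of_notMem hx, norm_zero]
      positivity
  -- the high part is small in `L¹`
  have hhigh_le : ∫ x, ‖Eᶜ.indicator f x‖ ≤ l / 2 := by
    rw [integral_norm_eq_lintegral_enorm hhigh.1]
    refine ENNReal.toReal_le_of_le_ofReal (by positivity) ?_
    calc ∫⁻ x, ‖Eᶜ.indicator f x‖ₑ
        ≤ ∫⁻ x, ENNReal.ofReal (l / (2 * a)) * ‖f x‖ₑ ^ (3 / 2 : ℝ) := by
          refine lintegral_mono fun x => ?_
          by_cases hx : x ∈ E
          · simp [Set.indicator_of_notMem (Set.notMem_compl_iff.2 hx)]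
          · rw [Set.indicator_of_mem (Set.mem_compl hx), ← ofReal_norm,
              ENNReal.ofReal_rpow_of_nonneg (norm_nonneg _) (by norm_num),
              ← ENNReal.ofReal_mul (by positivity)]
            refine ENNReal.ofReal_le_ofReal ?_
            have hx' : 4 * a ^ 2 < ‖f x‖ * l ^ 2 := not_le.1 hx
            have hs : ‖f x‖ ^ (3 / 2 : ℝ) = ‖f x‖ * √‖f x‖ := by
              rw [Real.sqrt_eq_rpow, show (3 / 2 : ℝ) = 1 + 1 / 2 by norm_num,
                Real.rpow_add' (norm_nonneg _) (by norm_num), Real.rpow_one]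
            have h2 : 2 * a ≤ l * √‖f x‖ := by
              rw [← Real.sqrt_sq hl.le, ← Real.sqrt_mul (by positivity)]
              refine Real.le_sqrt_of_sq_le ?_
              nlinarith
            rw [hs, div_mul_eq_mul_div, le_div_iff₀ (by positivity)]
            nlinarith [norm_nonneg (f x)]
      _ = ENNReal.ofReal (l / 2) := by
          rw [lintegral_const_mul' _ _ ENNReal.ofReal_ne_top, hfa,
            ← ENNReal.ofReal_mul (by positivity)]
          congr 1
          field_simp
  have hsub : {y | l < ‖𝓕 f y‖} ⊆
      {y | ENNReal.ofReal ((l / 2) ^ 2) ≤ ‖𝓕 (E.indicator f) y‖ₑ ^ (2 : ℝ)} := by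
    intro y hy
    have hy : l < ‖𝓕 f y‖ := hy
    have hadd : 𝓕 f y = 𝓕 (E.indicator f) y + 𝓕 (Eᶜ.indicator f) y := by
      have := VectorFourier.fourierIntegral_add (e := Real.fourierChar) (μ := (volume : Measure V))
        (L := innerₗ V) Real.continuous_fourierChar continuous_inner hlow hhigh
      rw [Set.indicator_self_add_compl] at this
      exact congrFun this y
    have h3 := (norm_fourier_le (Eᶜ.indicator f) y).trans hhigh_le
    have h4 : l / 2 ≤ ‖𝓕 (E.indicator f) y‖ := by
      have := norm_add_le (𝓕 (E.indicator f) y) (𝓕 (Eᶜ.indicator f) y)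
      rw [← hadd] at this
      linarith
    change ENNReal.ofReal ((l / 2) ^ 2) ≤ ‖𝓕 (E.indicator f) y‖ₑ ^ (2 : ℝ)
    rw [← ofReal_norm, ENNReal.ofReal_rpow_of_nonneg (norm_nonneg _) (by norm_num)]
    refine ENNReal.ofReal_le_ofReal ?_
    rw [Real.rpow_two]
    gcongr
  have hcheb := mul_meas_ge_le_lintegral (μ := (volume : Measure V))
    (((continuous_fourier_of_integrable hlow).measurable.enorm).pow_const (2 : ℝ))
    (ENNReal.ofReal ((l / 2) ^ 2))
  rw [lintegral_enorm_fourier_sq hlow hlow2] at hcheb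
  have hind : ∀ x, ‖E.indicator f x‖ₑ ^ (2 : ℝ) = E.indicator (fun x => ‖f x‖ₑ ^ (2 : ℝ)) x := by
    intro x
    by_cases hx : x ∈ E
    · simp [hx]
    · simp [hx]
  simp_rw [hind] at hcheb
  calc volume {y | l < ‖𝓕 f y‖} * ENNReal.ofReal (l ^ 2)
      = 4 * (ENNReal.ofReal ((l / 2) ^ 2) * volume {y | l < ‖𝓕 f y‖}) := by
        rw [show l ^ 2 = 4 * (l / 2) ^ 2 by ring, ENNReal.ofReal_mul (by norm_num)]
        norm_num
        ring
    _ ≤ _ := by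
        gcongr
        exact le_trans (by gcongr) hcheb

/-- The **Hausdorff–Young inequality** from `L^{3/2}` to `L³` (with a non-sharp constant), by real
interpolation between the trivial bound `L¹ → L^∞` and Plancherel's theorem. -/
theorem lintegral_enorm_fourier_cube_le {f : V → ℂ} (hf : Integrable f) :
    ∫⁻ y, ‖𝓕 f y‖ₑ ^ (3 : ℝ) ≤ 24 * (∫⁻ x, ‖f x‖ₑ ^ (3 / 2 : ℝ)) ^ 2 := by
  wlog hfm : StronglyMeasurable f generalizing f
  · have h := this (hf.congr hf.1.ae_eq_mk) hf.1.stronglyMeasurable_mk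
    have e1 : 𝓕 f = 𝓕 (hf.1.mk f) := funext fun y => Real.fourier_congr_ae hf.1.ae_eq_mk y
    have e2 : ∫⁻ x, ‖f x‖ₑ ^ (3 / 2 : ℝ) = ∫⁻ x, ‖hf.1.mk f x‖ₑ ^ (3 / 2 : ℝ) := by
      refine lintegral_congr_ae ?_
      filter_upwards [hf.1.ae_eq_mk] with x hx
      rw [hx]
    rwa [e1, e2]
  rcases eq_or_ne (∫⁻ x, ‖f x‖ₑ ^ (3 / 2 : ℝ)) ∞ with htop | htop
  · simp [htop]
  rcases eq_or_ne (∫⁻ x, ‖f x‖ₑ ^ (3 / 2 : ℝ)) 0 with h0 | h0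
  · have hf0 : f =ᵐ[volume] 0 := by
      rw [lintegral_eq_zero_iff (hfm.measurable.enorm.pow_const _)] at h0
      filter_upwards [h0] with x hx
      simpa using hx
    have : ∀ y, 𝓕 f y = 0 := fun y => by
      rw [Real.fourier_congr_ae hf0, Real.fourier_eq]
      simp
    simp [this]
  set a : ℝ := (∫⁻ x, ‖f x‖ₑ ^ (3 / 2 : ℝ)).toReal with ha_def
  have ha : 0 < a := ENNReal.toReal_pos h0 htop
  have hfa : ∫⁻ x, ‖f x‖ₑ ^ (3 / 2 : ℝ) = ENNReal.ofReal a := (ENNReal.ofReal_toReal htop).symm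
  have hlayer := lintegral_rpow_eq_lintegral_meas_lt_mul (volume : Measure V)
    (f := fun y => ‖𝓕 f y‖) (Filter.Eventually.of_forall fun y => norm_nonneg _)
    (continuous_fourier_of_integrable hf).norm.measurable.aemeasurable (p := 3) (by norm_num)
  have hLHS : ∫⁻ y, ‖𝓕 f y‖ₑ ^ (3 : ℝ) = ∫⁻ y, ENNReal.ofReal (‖𝓕 f y‖ ^ (3 : ℝ)) := by
    refine lintegral_congr fun y => ?_
    rw [← ofReal_norm, ENNReal.ofReal_rpow_of_nonneg (norm_nonneg _) (by norm_num)]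
  have hmeas : Measurable (Function.uncurry fun (l : ℝ) (x : V) =>
      {x | ‖f x‖ * l ^ 2 ≤ 4 * a ^ 2}.indicator (fun x => ‖f x‖ₑ ^ (2 : ℝ)) x) := by
    have hset : MeasurableSet {q : ℝ × V | ‖f q.2‖ * q.1 ^ 2 ≤ 4 * a ^ 2} :=
      measurableSet_le (((hfm.measurable.comp measurable_snd).norm).mul (measurable_fst.pow_const 2))
        measurable_const
    exact (((hfm.measurable.comp measurable_snd).enorm).pow_const (2 : ℝ)).indicator hset
  -- for each `x`, the levels `l` at which `x` lies in the low part form an interval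
  have hinner : ∀ x, ∫⁻ l in Set.Ioi (0 : ℝ),
      {x | ‖f x‖ * l ^ 2 ≤ 4 * a ^ 2}.indicator (fun x => ‖f x‖ₑ ^ (2 : ℝ)) x ≤
        ENNReal.ofReal (2 * a) * ‖f x‖ₑ ^ (3 / 2 : ℝ) := by
    intro x
    rcases eq_or_ne (f x) 0 with hx | hx
    · have : ∀ l : ℝ, {x | ‖f x‖ * l ^ 2 ≤ 4 * a ^ 2}.indicator
          (fun x => ‖f x‖ₑ ^ (2 : ℝ)) x = 0 := by
        intro l
        simp [Set.indicator_apply, hx]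
      simp_rw [this, lintegral_zero]
      exact zero_le
    · have hpos : 0 < ‖f x‖ := norm_pos_iff.2 hx
      have hle : ∀ l ∈ Set.Ioi (0 : ℝ), {x | ‖f x‖ * l ^ 2 ≤ 4 * a ^ 2}.indicator
          (fun x => ‖f x‖ₑ ^ (2 : ℝ)) x ≤
          (Set.Ioc 0 (2 * a / √‖f x‖)).indicator (fun _ => ‖f x‖ₑ ^ (2 : ℝ)) l := by
        intro l hl
        have hl : 0 < l := hl
        by_cases h : ‖f x‖ * l ^ 2 ≤ 4 * a ^ 2
        · have hmem : l ∈ Set.Ioc 0 (2 * a / √‖f x‖) := by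
            refine ⟨hl, ?_⟩
            rw [le_div_iff₀ (Real.sqrt_pos.2 hpos)]
            refine abs_le_of_sq_le_sq' ?_ (by positivity) |>.2
            rw [mul_pow, Real.sq_sqrt hpos.le]
            nlinarith
          rw [Set.indicator_of_mem hmem]
          exact Set.indicator_le_self _ _ x
        · rw [Set.indicator_of_notMem (show x ∉ {x | ‖f x‖ * l ^ 2 ≤ 4 * a ^ 2} from h)]
          exact zero_le
      refine (setLIntegral_mono' measurableSet_Ioi hle).trans ?_
      refine (setLIntegral_le_lintegral _ _).trans ?_
      rw [lintegral_indicator measurableSet_Ioc, lintegral_const, Measure.restrict_apply_univ,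
        Real.volume_Ioc, sub_zero, ← ofReal_norm,
        ENNReal.ofReal_rpow_of_nonneg hpos.le (by norm_num),
        ENNReal.ofReal_rpow_of_nonneg hpos.le (by norm_num), ← ENNReal.ofReal_mul (by positivity),
        ← ENNReal.ofReal_mul (by positivity)]
      refine ENNReal.ofReal_le_ofReal (le_of_eq ?_)
      rw [show (2 : ℝ) = 3 / 2 + 1 / 2 by norm_num, Real.rpow_add hpos, ← Real.sqrt_eq_rpow]
      have := Real.sqrt_pos.2 hpos
      field_simp
      norm_num
  rw [hLHS, hlayer, hfa]
  calc ENNReal.ofReal 3 * ∫⁻ l in Set.Ioi (0 : ℝ), volume {y | l < ‖𝓕 f y‖} *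
        ENNReal.ofReal (l ^ ((3 : ℝ) - 1))
      ≤ ENNReal.ofReal 3 * ∫⁻ l in Set.Ioi (0 : ℝ), 4 * ∫⁻ x,
          {x | ‖f x‖ * l ^ 2 ≤ 4 * a ^ 2}.indicator (fun x => ‖f x‖ₑ ^ (2 : ℝ)) x := by
        refine mul_le_mul_right ?_ _
        refine setLIntegral_mono' measurableSet_Ioi fun l hl => ?_
        rw [show (3 : ℝ) - 1 = 2 by norm_num, Real.rpow_two]
        exact measure_lt_norm_fourier_mul_sq_le hf hfm ha hfa hl
    _ = ENNReal.ofReal 3 * (4 * ∫⁻ x, ∫⁻ l in Set.Ioi (0 : ℝ),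
          {x | ‖f x‖ * l ^ 2 ≤ 4 * a ^ 2}.indicator (fun x => ‖f x‖ₑ ^ (2 : ℝ)) x) := by
        rw [lintegral_const_mul' _ _ (by norm_num), lintegral_lintegral_swap hmeas.aemeasurable]
    _ ≤ ENNReal.ofReal 3 * (4 * ∫⁻ x, ENNReal.ofReal (2 * a) * ‖f x‖ₑ ^ (3 / 2 : ℝ)) := by
        gcongr
        exact hinner _
    _ = 24 * ENNReal.ofReal a ^ 2 := by
        rw [lintegral_const_mul' _ _ ENNReal.ofReal_ne_top, hfa, ENNReal.ofReal_mul (by norm_num)]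
        norm_num
        ring

end FourierIntegral

/-! ### Fractional integration against a Morrey-type norm -/

/-- The kernel `|z|^{-1/2}` of fractional integration of order `1/2`. -/
noncomputable def rieszKernel (z : ℝ) : ℝ≥0∞ := ENNReal.ofReal (|z| ^ (-1 / 2 : ℝ))

theorem measurable_rieszKernel : Measurable rieszKernel := by
  unfold rieszKernel; fun_prop

theorem lintegral_rieszKernel_near_le (c : ℝ) {R : ℝ} (hR : 0 < R) :
    ∫⁻ y in {y | |c - y| ≤ R}, rieszKernel (c - y) ≤ ENNReal.ofReal (4 * √R) := by
  have hm : MeasurableSet {y : ℝ | |c - y| ≤ R} := measurableSet_le (by fun_prop) measurable_const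
  set f : ℝ → ℝ := (Set.Iic R).indicator (fun x => x ^ (-1 / 2 : ℝ)) with hf
  have hfm : Measurable f := (by fun_prop : Measurable fun x : ℝ => x ^ (-1 / 2 : ℝ)).indicator
    measurableSet_Iic
  have hf0 : ∀ x, 0 ≤ f |x| := fun x => Set.indicator_apply_nonneg fun _ =>
    Real.rpow_nonneg (abs_nonneg x) _
  have hint : ∫ x in Set.Ioi 0, f x = 2 * √R := by
    rw [hf, setIntegral_indicator measurableSet_Iic, Set.Ioi_inter_Iic,
      ← intervalIntegral.integral_of_le hR.le, integral_rpow (Or.inl (by norm_num)),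
      Real.sqrt_eq_rpow]
    norm_num
    ring
  have hval : ∫ x, f |x| = 4 * √R := by rw [integral_comp_abs, hint]; ring
  calc ∫⁻ y in {y | |c - y| ≤ R}, rieszKernel (c - y)
      = ∫⁻ y, ENNReal.ofReal (f |c - y|) := by
        rw [← lintegral_indicator hm]
        refine lintegral_congr fun y => ?_
        by_cases hy : |c - y| ≤ R
        · rw [Set.indicator_of_mem (show y ∈ {y : ℝ | |c - y| ≤ R} from hy), hf,
            Set.indicator_of_mem (Set.mem_Iic.2 hy), rieszKernel]
        · rw [Set.indicator_of_notMem (show y ∉ {y : ℝ | |c - y| ≤ R} from hy), hf,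
            Set.indicator_of_notMem (fun h => hy (Set.mem_Iic.1 h)), ENNReal.ofReal_zero]
    _ = ∫⁻ y, ENNReal.ofReal (f |y|) := lintegral_sub_left_eq_self (fun y => ENNReal.ofReal (f |y|)) c
    _ ≤ ENNReal.ofReal (4 * √R) := by
        rw [← hval, ofReal_integral_eq_lintegral_ofReal _ (Filter.Eventually.of_forall hf0)]
        exact Integrable.of_integral_ne_zero (by rw [hval]; positivity)

/-- If `G` has mass at most `A r ^ b`, `b < 1/2`, on intervals of radius `r ≥ R` around `c`, then
summing over dyadic shells bounds its fractional integral away from `c`. -/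
theorem lintegral_rieszKernel_far_le {G : ℝ → ℝ≥0∞} {A b c R : ℝ} (hA : 0 ≤ A)
    (hb : b < 1 / 2) (hR : 0 < R)
    (hG : ∀ r, 0 < r → ∫⁻ y in Set.Icc (c - r) (c + r), G y ≤ ENNReal.ofReal (A * r ^ b)) :
    ∫⁻ y in {y | R < |c - y|}, G y * rieszKernel (c - y) ≤
      ENNReal.ofReal (2 ^ b * (1 - 2 ^ (b - 1 / 2))⁻¹ * (A * R ^ (b - 1 / 2))) := by
  set q : ℝ := 2 ^ (b - 1 / 2) with hq
  have hq0 : 0 ≤ q := by positivity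
  have hq1 : q < 1 := Real.rpow_lt_one_of_one_lt_of_neg (by norm_num) (by linarith)
  set D : ℕ → Set ℝ := fun k => {y | 2 ^ k * R ≤ |c - y| ∧ |c - y| < 2 ^ (k + 1) * R} with hD
  have hDm : ∀ k, MeasurableSet (D k) := fun k =>
    (measurableSet_le (f := fun _ : ℝ => 2 ^ k * R) (g := fun y => |c - y|) measurable_const
      (by fun_prop)).inter (measurableSet_lt (f := fun y => |c - y|)
        (g := fun _ : ℝ => 2 ^ (k + 1) * R) (by fun_prop) measurable_const)
  have hcover : {y | R < |c - y|} ⊆ ⋃ k, D k := by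
    intro y hy
    have hy : R < |c - y| := hy
    obtain ⟨n, hn, hn'⟩ := exists_nat_pow_near ((one_le_div hR).2 hy.le) one_lt_two
    exact Set.mem_iUnion.2 ⟨n, (le_div_iff₀ hR).1 hn, (div_lt_iff₀ hR).1 hn'⟩
  have hshell : ∀ k, ∫⁻ y in D k, G y * rieszKernel (c - y) ≤
      ENNReal.ofReal (2 ^ b * (A * R ^ (b - 1 / 2)) * q ^ k) := by
    intro k
    have hr : 0 < (2 : ℝ) ^ k * R := by positivity
    calc ∫⁻ y in D k, G y * rieszKernel (c - y)
        ≤ ∫⁻ y in D k, G y * ENNReal.ofReal ((2 ^ k * R) ^ (-1 / 2 : ℝ)) := by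
          refine setLIntegral_mono' (hDm k) fun y hy => ?_
          refine mul_le_mul_right (ENNReal.ofReal_le_ofReal ?_) _
          exact Real.rpow_le_rpow_of_nonpos hr hy.1 (by norm_num)
      _ ≤ ENNReal.ofReal (A * (2 ^ (k + 1) * R) ^ b) *
            ENNReal.ofReal ((2 ^ k * R) ^ (-1 / 2 : ℝ)) := by
          rw [lintegral_mul_const' _ _ ENNReal.ofReal_ne_top]
          refine mul_le_mul_left (le_trans (lintegral_mono_set fun y hy => ?_)
            (hG (2 ^ (k + 1) * R) (by positivity))) _
          have := abs_le.1 hy.2.le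
          constructor <;> linarith
      _ = ENNReal.ofReal (2 ^ b * (A * R ^ (b - 1 / 2)) * q ^ k) := by
          rw [← ENNReal.ofReal_mul (by positivity)]
          congr 1
          rw [pow_succ, mul_right_comm (2 ^ k) 2 R, Real.mul_rpow hr.le (by norm_num), hq,
            ← Real.rpow_natCast ((2 : ℝ) ^ (b - 1 / 2)) k, ← Real.rpow_mul (by norm_num),
            mul_comm (b - 1 / 2), Real.rpow_mul (by norm_num), Real.rpow_natCast]
          have h1 : ((2 : ℝ) ^ k * R) ^ b * (2 ^ k * R) ^ (-1 / 2 : ℝ) =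
              R ^ (b - 1 / 2) * ((2 : ℝ) ^ k) ^ (b - 1 / 2) := by
            rw [← Real.rpow_add hr, show b + -1 / 2 = b - 1 / 2 by ring,
              Real.mul_rpow (by positivity) hR.le, mul_comm]
          linear_combination (A * 2 ^ b) * h1
  calc ∫⁻ y in {y | R < |c - y|}, G y * rieszKernel (c - y)
      ≤ ∫⁻ y in ⋃ k, D k, G y * rieszKernel (c - y) := lintegral_mono_set hcover
    _ ≤ ∑' k, ∫⁻ y in D k, G y * rieszKernel (c - y) := lintegral_iUnion_le _ _
    _ ≤ ∑' k, ENNReal.ofReal (2 ^ b * (A * R ^ (b - 1 / 2)) * q ^ k) :=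
        ENNReal.tsum_le_tsum hshell
    _ = _ := by
        rw [← ENNReal.ofReal_tsum_of_nonneg (fun k => by positivity)
          ((summable_geometric_of_lt_one hq0 hq1).mul_left _), tsum_mul_left,
          tsum_geometric_of_lt_one hq0 hq1]
        congr 1
        ring

/-- The constant in the estimate of the truncated fractional integral. -/
noncomputable def rieszConst (p : ℝ) : ℝ :=
  4 + 2 ^ (1 - p / 2) * (1 - 2 ^ (1 - p / 2 - 1 / 2))⁻¹ * 2 ^ (1 - p / 2)

theorem rieszConst_pos {p : ℝ} (hp : 1 < p) : 0 < rieszConst p := by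
  have : (2 : ℝ) ^ (1 - p / 2 - 1 / 2) < 1 :=
    Real.rpow_lt_one_of_one_lt_of_neg (by norm_num) (by linarith)
  have := sub_pos.2 this
  unfold rieszConst
  positivity

/-- The heart of the refinement. Below the height `M`, the fractional integral of `F ^ (3/2)` is
controlled by the Morrey-type quantity `S`: within the radius `(S / M) ^ 2` by `F ≤ M`, outside it
by the hypothesis, through `F ^ (3/2) ≤ M ^ (3/2 - p) * F ^ p`. -/
theorem rpow_mul_lintegral_rieszKernel_le {F : ℝ → ℝ≥0∞} (hF : Measurable F) {p S : ℝ}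
    (hp : 1 < p) (hp' : p ≤ 3 / 2) (hS : 0 < S)
    (hFS : ∀ c r, 0 < r → ∫⁻ y in Set.Icc (c - r) (c + r), F y ^ p ≤
      ENNReal.ofReal (S ^ p * (2 * r) ^ (1 - p / 2))) (M : ℝ≥0∞) (c : ℝ) :
    M ^ (3 / 2 : ℝ) * ∫⁻ y in {y | F y ≤ M}, F y ^ (3 / 2 : ℝ) * rieszKernel (c - y) ≤
      ENNReal.ofReal (rieszConst p * S) * M ^ (2 : ℝ) := by
  have hC := rieszConst_pos hp
  rcases eq_or_ne M ∞ with hM | hM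
  · rw [hM, ENNReal.top_rpow_of_pos (by norm_num : (0 : ℝ) < 2), ENNReal.mul_top]
    · exact le_top
    · simpa using mul_pos hC hS
  rcases eq_or_ne M 0 with hM0 | hM0
  · simp [hM0]
  obtain ⟨m, hm, rfl⟩ : ∃ m : ℝ, 0 < m ∧ M = ENNReal.ofReal m :=
    ⟨M.toReal, ENNReal.toReal_pos hM0 hM, (ENNReal.ofReal_toReal hM).symm⟩
  -- the radius at which the near and the far contribution balance
  set R : ℝ := (S / m) ^ 2 with hR
  have hR0 : 0 < R := by positivity
  have hFm : MeasurableSet {y | F y ≤ ENNReal.ofReal m} := measurableSet_le hF measurable_const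
  have hnear : MeasurableSet {y : ℝ | |c - y| ≤ R} := measurableSet_le (by fun_prop) measurable_const
  have hfar : MeasurableSet {y : ℝ | R < |c - y|} := measurableSet_lt measurable_const (by fun_prop)
  -- pointwise bound by the near and the far contribution
  have hpt : ∀ y ∈ {y | F y ≤ ENNReal.ofReal m}, F y ^ (3 / 2 : ℝ) * rieszKernel (c - y) ≤
      ENNReal.ofReal (m ^ (3 / 2 : ℝ)) *
        {y : ℝ | |c - y| ≤ R}.indicator (fun y => rieszKernel (c - y)) y +
      ENNReal.ofReal (m ^ (3 / 2 - p)) *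
        {y : ℝ | R < |c - y|}.indicator (fun y => F y ^ p * rieszKernel (c - y)) y := by
    intro y hy
    have hy : F y ≤ ENNReal.ofReal m := hy
    by_cases h : |c - y| ≤ R
    · refine le_add_right ?_
      rw [Set.indicator_of_mem (show y ∈ {y : ℝ | |c - y| ≤ R} from h),
        ← ENNReal.ofReal_rpow_of_pos hm]
      gcongr
    · refine le_add_left ?_
      rw [Set.indicator_of_mem (show y ∈ {y : ℝ | R < |c - y|} from not_le.1 h), ← mul_assoc,
        ← ENNReal.ofReal_rpow_of_pos hm]
      refine mul_le_mul_left ?_ _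
      rw [show (3 / 2 : ℝ) = (3 / 2 - p) + p by ring,
        ENNReal.rpow_add_of_nonneg _ _ (by linarith) (by linarith), add_sub_cancel_right]
      gcongr
  have hfarb : ∫⁻ y in {y | R < |c - y|}, F y ^ p * rieszKernel (c - y) ≤
      ENNReal.ofReal (2 ^ (1 - p / 2) * (1 - 2 ^ (1 - p / 2 - 1 / 2))⁻¹ *
        (S ^ p * 2 ^ (1 - p / 2) * R ^ (1 - p / 2 - 1 / 2))) := by
    refine lintegral_rieszKernel_far_le (by positivity) (by linarith) hR0 fun r hr => ?_
    rw [mul_assoc, ← Real.mul_rpow (by norm_num) hr.le]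
    exact hFS c r hr
  have hq := sub_pos.2 (Real.rpow_lt_one_of_one_lt_of_neg (x := (2 : ℝ)) (by norm_num)
    (by linarith : 1 - p / 2 - 1 / 2 < 0))
  calc ENNReal.ofReal m ^ (3 / 2 : ℝ) *
        ∫⁻ y in {y | F y ≤ ENNReal.ofReal m}, F y ^ (3 / 2 : ℝ) * rieszKernel (c - y)
      ≤ ENNReal.ofReal (m ^ (3 / 2 : ℝ)) *
        (ENNReal.ofReal (m ^ (3 / 2 : ℝ)) * ENNReal.ofReal (4 * √R) +
          ENNReal.ofReal (m ^ (3 / 2 - p)) *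
          ENNReal.ofReal (2 ^ (1 - p / 2) * (1 - 2 ^ (1 - p / 2 - 1 / 2))⁻¹ *
            (S ^ p * 2 ^ (1 - p / 2) * R ^ (1 - p / 2 - 1 / 2)))) := by
        rw [ENNReal.ofReal_rpow_of_pos hm]
        refine mul_le_mul_right ?_ _
        refine (setLIntegral_mono' hFm hpt).trans ?_
        refine (setLIntegral_le_lintegral _ _).trans ?_
        rw [lintegral_add_left, lintegral_const_mul' _ _ ENNReal.ofReal_ne_top,
          lintegral_const_mul' _ _ ENNReal.ofReal_ne_top, lintegral_indicator hnear,
          lintegral_indicator hfar]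
        · gcongr
          exact lintegral_rieszKernel_near_le c hR0
        · exact ((measurable_rieszKernel.comp (measurable_const.sub measurable_id)).indicator
            hnear).const_mul _
    _ = ENNReal.ofReal (rieszConst p * S) * ENNReal.ofReal m ^ (2 : ℝ) := by
        rw [ENNReal.ofReal_rpow_of_pos hm, ← ENNReal.ofReal_mul (by positivity),
          ← ENNReal.ofReal_mul (by positivity), ← ENNReal.ofReal_add (by positivity)
            (by positivity), ← ENNReal.ofReal_mul (by positivity),
          ← ENNReal.ofReal_mul (by positivity)]
        congr 1
        have hsqrt : √R = S / m := Real.sqrt_sq (by positivity)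
        have hRp : R ^ (1 - p / 2 - 1 / 2) = (S / m) ^ (1 - p) := by
          rw [hR, ← Real.rpow_two, ← Real.rpow_mul (by positivity)]
          congr 1
          ring
        have h1 : m ^ (3 / 2 : ℝ) * m ^ (3 / 2 : ℝ) = m ^ (2 : ℝ) * m := by
          rw [← Real.rpow_add hm, ← Real.rpow_add_one hm.ne']
          norm_num
        have h2 : m ^ (3 / 2 : ℝ) * (m ^ (3 / 2 - p) * (S ^ p * (S / m) ^ (1 - p))) =
            m ^ (2 : ℝ) * S := by
          rw [Real.div_rpow hS.le hm.le, Real.rpow_sub hS, Real.rpow_sub hm, Real.rpow_sub hm,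
            Real.rpow_one, Real.rpow_one]
          have := Real.rpow_pos_of_pos hm p
          have := Real.rpow_pos_of_pos hS p
          field_simp
          rw [← Real.rpow_two, ← Real.rpow_mul hm.le]
          norm_num
          ring
        rw [hsqrt, hRp, rieszConst]
        have h3 : m ^ (3 / 2 : ℝ) * (m ^ (3 / 2 : ℝ) * (4 * (S / m))) = 4 * S * m ^ (2 : ℝ) := by
          rw [← mul_assoc, h1]
          field_simp
        linear_combination h3 +
          (2 ^ (1 - p / 2) * (1 - 2 ^ (1 - p / 2 - 1 / 2))⁻¹ * 2 ^ (1 - p / 2)) * h2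

theorem rieszKernel_abs_sub_abs_le (x y : ℝ) :
    rieszKernel (|x| - |y|) ≤ rieszKernel (x - y) + rieszKernel (-x - y) := by
  have h : rieszKernel (|x| - |y|) = rieszKernel (x - y) ∨
      rieszKernel (|x| - |y|) = rieszKernel (-x - y) := by
    unfold rieszKernel
    rcases abs_cases x with ⟨hx, _⟩ | ⟨hx, _⟩ <;> rcases abs_cases y with ⟨hy, _⟩ | ⟨hy, _⟩ <;>
      rw [hx, hy]
    · exact Or.inl rfl
    · right; rw [← abs_neg]; ring_nf
    · exact Or.inr rfl
    · left; rw [← abs_neg]; ring_nf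
  rcases h with h | h <;> rw [h]
  · exact le_self_add
  · exact le_add_self

theorem rieszKernel_neg (z : ℝ) : rieszKernel (-z) = rieszKernel z := by
  rw [rieszKernel, abs_neg, rieszKernel]

/-- A Morrey-refined Hardy–Littlewood–Sobolev inequality. -/
theorem lintegral_lintegral_rieszKernel_le {F : ℝ → ℝ≥0∞} (hF : Measurable F) {p S : ℝ}
    (hp : 1 < p) (hp' : p ≤ 3 / 2) (hS : 0 < S)
    (hFS : ∀ c r, 0 < r → ∫⁻ y in Set.Icc (c - r) (c + r), F y ^ p ≤
      ENNReal.ofReal (S ^ p * (2 * r) ^ (1 - p / 2))) :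
    ∫⁻ x, ∫⁻ y, F x ^ (3 / 2 : ℝ) * F y ^ (3 / 2 : ℝ) * rieszKernel (|x| - |y|) ≤
      ENNReal.ofReal (4 * rieszConst p * S) * ∫⁻ x, F x ^ (2 : ℝ) := by
  set k : ℝ → ℝ → ℝ≥0∞ := fun x y =>
    F x ^ (3 / 2 : ℝ) * F y ^ (3 / 2 : ℝ) * rieszKernel (|x| - |y|) with hk
  have hsymm : ∀ x y, k x y = k y x := by
    intro x y
    simp only [hk]
    rw [← rieszKernel_neg, neg_sub, mul_comm (F x ^ _)]
  have hkm : Measurable (Function.uncurry k) := by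
    have h1 : Measurable fun q : ℝ × ℝ => rieszKernel (|q.1| - |q.2|) :=
      measurable_rieszKernel.comp (by fun_prop)
    have h2 : Measurable fun q : ℝ × ℝ => F q.1 := hF.comp measurable_fst
    have h3 : Measurable fun q : ℝ × ℝ => F q.2 := hF.comp measurable_snd
    exact ((h2.pow_const _).mul (h3.pow_const _)).mul h1
  set T : Set (ℝ × ℝ) := {q | F q.2 ≤ F q.1} with hT
  have hTm : MeasurableSet T := measurableSet_le (hF.comp measurable_snd) (hF.comp measurable_fst)
  set kT : ℝ → ℝ → ℝ≥0∞ := fun x y => T.indicator (Function.uncurry k) (x, y) with hkT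
  have hkTm : Measurable (Function.uncurry kT) := hkm.indicator hTm
  -- by symmetry it suffices to integrate over `F y ≤ F x`
  have hle : ∀ x y, k x y ≤ kT x y + kT y x := by
    intro x y
    rcases le_total (F y) (F x) with h | h
    · refine le_add_right (le_of_eq ?_)
      exact (Set.indicator_of_mem (show (x, y) ∈ T from h) (Function.uncurry k)).symm
    · refine le_add_left (le_of_eq ?_)
      rw [hsymm]
      exact (Set.indicator_of_mem (show (y, x) ∈ T from h) (Function.uncurry k)).symm
  have hinner : ∀ x, ∫⁻ y, kT x y ≤ ENNReal.ofReal (2 * (rieszConst p * S)) * F x ^ (2 : ℝ) := by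
    intro x
    have hFx : MeasurableSet {y | F y ≤ F x} := measurableSet_le hF measurable_const
    calc ∫⁻ y, kT x y ≤ ∫⁻ y in {y | F y ≤ F x}, (F x ^ (3 / 2 : ℝ) *
          (F y ^ (3 / 2 : ℝ) * rieszKernel (x - y)) +
          F x ^ (3 / 2 : ℝ) * (F y ^ (3 / 2 : ℝ) * rieszKernel (-x - y))) := by
          rw [← lintegral_indicator hFx]
          refine lintegral_mono fun y => ?_
          by_cases h : F y ≤ F x
          · rw [Set.indicator_of_mem (show y ∈ {y | F y ≤ F x} from h)]
            refine (Set.indicator_le_self _ _ _).trans ?_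
            simp only [hk, Function.uncurry]
            rw [← mul_add, ← mul_add, ← mul_assoc]
            exact mul_le_mul_right (rieszKernel_abs_sub_abs_le x y) _
          · simp only [hkT]
            rw [Set.indicator_of_notMem (show (x, y) ∉ T from h)]
            exact zero_le
      _ = F x ^ (3 / 2 : ℝ) * (∫⁻ y in {y | F y ≤ F x}, F y ^ (3 / 2 : ℝ) * rieszKernel (x - y)) +
          F x ^ (3 / 2 : ℝ) *
            ∫⁻ y in {y | F y ≤ F x}, F y ^ (3 / 2 : ℝ) * rieszKernel (-x - y) := by
          have hm : ∀ c : ℝ, Measurable fun y => F y ^ (3 / 2 : ℝ) * rieszKernel (c - y) :=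
            fun c => (hF.pow_const _).mul (measurable_rieszKernel.comp (by fun_prop))
          rw [lintegral_add_left ((hm x).const_mul _), lintegral_const_mul _ (hm x),
            lintegral_const_mul _ (hm (-x))]
      _ ≤ ENNReal.ofReal (rieszConst p * S) * F x ^ (2 : ℝ) +
          ENNReal.ofReal (rieszConst p * S) * F x ^ (2 : ℝ) :=
          add_le_add (rpow_mul_lintegral_rieszKernel_le hF hp hp' hS hFS _ _)
            (rpow_mul_lintegral_rieszKernel_le hF hp hp' hS hFS _ _)
      _ = _ := by
          rw [ENNReal.ofReal_mul zero_le_two, ← two_mul, ENNReal.ofReal_ofNat, mul_assoc]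
  calc ∫⁻ x, ∫⁻ y, k x y ≤ ∫⁻ x, ∫⁻ y, (kT x y + kT y x) :=
        lintegral_mono fun x => lintegral_mono fun y => hle x y
    _ = (∫⁻ x, ∫⁻ y, kT x y) + ∫⁻ x, ∫⁻ y, kT y x := by
        rw [← lintegral_add_left (f := fun x => ∫⁻ y, kT x y) hkTm.lintegral_prod_right']
        refine lintegral_congr fun x => lintegral_add_left ?_ _
        exact hkTm.comp (measurable_const.prodMk measurable_id)
    _ = 2 * ∫⁻ x, ∫⁻ y, kT x y := by
        rw [lintegral_lintegral_swap (f := fun x y => kT y x)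
          (hkTm.comp measurable_swap).aemeasurable, two_mul]
    _ ≤ 2 * ∫⁻ x, ENNReal.ofReal (2 * (rieszConst p * S)) * F x ^ (2 : ℝ) := by
        gcongr with x
        exact hinner x
    _ = _ := by
        rw [lintegral_const_mul' _ _ ENNReal.ofReal_ne_top, ← mul_assoc,
          show 4 * rieszConst p * S = 2 * (2 * (rieszConst p * S)) by ring,
          ENNReal.ofReal_mul zero_le_two (q := 2 * (rieszConst p * S))]
        norm_num

/-! ### The bilinear estimate for superpositions of Airy waves -/

/-- The Hausdorff–Young inequality on `ℝ × ℝ`, which carries no inner product; `ℂ` serves as a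
Euclidean model of the plane. -/
theorem lintegral_enorm_fourier_prod_cube_le {f : ℝ × ℝ → ℂ} (hf : Integrable f) :
    ∫⁻ z : ℝ × ℝ, ‖∫ q : ℝ × ℝ, Complex.exp (((-2 * Real.pi * (q.1 * z.1 + q.2 * z.2) : ℝ) : ℂ) *
      Complex.I) * f q‖ₑ ^ (3 : ℝ) ≤ 24 * (∫⁻ q, ‖f q‖ₑ ^ (3 / 2 : ℝ)) ^ 2 := by
  have he := Complex.volume_preserving_equiv_real_prod
  have hemb := Complex.measurableEquivRealProd.measurableEmbedding
  have hg : Integrable (f ∘ Complex.measurableEquivRealProd) :=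
    (he.integrable_comp_emb hemb).2 hf
  have key := lintegral_enorm_fourier_cube_le hg
  have h1 : ∀ w : ℂ, 𝓕 (f ∘ Complex.measurableEquivRealProd) w =
      ∫ q : ℝ × ℝ, Complex.exp (((-2 * Real.pi * (q.1 * (Complex.measurableEquivRealProd w).1 +
        q.2 * (Complex.measurableEquivRealProd w).2) : ℝ) : ℂ) * Complex.I) * f q := by
    intro w
    rw [Real.fourier_eq', ← he.integral_comp hemb]
    refine integral_congr_ae (Filter.Eventually.of_forall fun v => ?_)
    simp only [Function.comp_apply, smul_eq_mul, Complex.measurableEquivRealProd_apply]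
    congr 4
    rw [Complex.inner]
    simp
    ring
  simp_rw [h1] at key
  rw [← he.lintegral_comp_emb hemb, ← he.lintegral_comp_emb hemb]
  exact key

/-- The character `e^{i (t ξ³ + x ξ)}` at the space-time point `z = (t, x)`. -/
noncomputable def wavePhase (z : ℝ × ℝ) (ξ : ℝ) : ℂ :=
  Complex.exp (((z.1 * ξ ^ 3 + z.2 * ξ : ℝ) : ℂ) * Complex.I)

theorem norm_wavePhase (z : ℝ × ℝ) (ξ : ℝ) : ‖wavePhase z ξ‖ = 1 := by
  rw [wavePhase, Complex.norm_exp_ofReal_mul_I]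

theorem continuous_wavePhase_uncurry :
    Continuous fun q : (ℝ × ℝ) × ℝ => wavePhase q.1 q.2 := by
  unfold wavePhase
  fun_prop

theorem continuous_wavePhase (z : ℝ × ℝ) : Continuous (wavePhase z) := by
  unfold wavePhase
  fun_prop

theorem integrable_wavePhase_mul {h : ℝ → ℂ} (hh : Integrable h) (z : ℝ × ℝ) :
    Integrable fun ξ => wavePhase z ξ * h ξ :=
  hh.bdd_mul (continuous_wavePhase z).aestronglyMeasurable
    (Filter.Eventually.of_forall fun ξ => (norm_wavePhase z ξ).le)

/-- Two frequencies are sent to (minus `1 / (2 π)` times) the space-time frequency of the product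
of the two waves. -/
noncomputable def pairFreq (q : ℝ × ℝ) : ℝ × ℝ :=
  (-(2 * Real.pi)⁻¹ * (q.1 ^ 3 + q.2 ^ 3), -(2 * Real.pi)⁻¹ * (q.1 + q.2))

/-- The region on which `pairFreq` is injective with nonvanishing Jacobian. -/
def pairRegion : Set (ℝ × ℝ) := {q | q.1 < q.2 ∧ q.1 + q.2 ≠ 0}

theorem measurableSet_pairRegion : MeasurableSet pairRegion :=
  (measurableSet_lt measurable_fst measurable_snd).inter
    (measurableSet_eq_fun (measurable_fst.add measurable_snd) measurable_const).compl

/-- The derivative of `pairFreq`. -/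
noncomputable def fderivPairFreq (q : ℝ × ℝ) : ℝ × ℝ →L[ℝ] ℝ × ℝ :=
  (Matrix.toLin (.finTwoProd ℝ) (.finTwoProd ℝ)
    !![-(2 * Real.pi)⁻¹ * (3 * q.1 ^ 2), -(2 * Real.pi)⁻¹ * (3 * q.2 ^ 2);
      -(2 * Real.pi)⁻¹, -(2 * Real.pi)⁻¹]).toContinuousLinearMap

theorem hasFDerivAt_pairFreq (q : ℝ × ℝ) : HasFDerivAt pairFreq (fderivPairFreq q) q := by
  unfold fderivPairFreq pairFreq
  rw [Matrix.toLin_finTwoProd_toContinuousLinearMap]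
  have h1 : HasFDerivAt (fun q : ℝ × ℝ => q.1) (ContinuousLinearMap.fst ℝ ℝ ℝ) q := hasFDerivAt_fst
  have h2 : HasFDerivAt (fun q : ℝ × ℝ => q.2) (ContinuousLinearMap.snd ℝ ℝ ℝ) q := hasFDerivAt_snd
  have h := (((h1.pow 3).add (h2.pow 3)).const_mul (-(2 * Real.pi)⁻¹)).prodMk
    ((h1.add h2).const_mul (-(2 * Real.pi)⁻¹))
  refine h.congr_fderiv ?_
  ext <;> simp

theorem det_fderivPairFreq (q : ℝ × ℝ) :
    (fderivPairFreq q).det = ((2 * Real.pi)⁻¹) ^ 2 * (3 * (q.1 ^ 2 - q.2 ^ 2)) := by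
  simp only [fderivPairFreq, LinearMap.det_toContinuousLinearMap, LinearMap.det_toLin,
    Matrix.det_fin_two_of]
  ring

theorem abs_det_fderivPairFreq_pos {q : ℝ × ℝ} (hq : q ∈ pairRegion) :
    0 < |(fderivPairFreq q).det| := by
  rw [det_fderivPairFreq, abs_pos]
  have h1 : q.1 - q.2 ≠ 0 := (sub_neg.2 hq.1).ne
  have h2 := hq.2
  have : q.1 ^ 2 - q.2 ^ 2 = (q.1 - q.2) * (q.1 + q.2) := by ring
  rw [this]
  positivity

/-- The sum `q.1 + q.2 ≠ 0` and the sum of cubes determine the product, hence the unordered pair. -/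
theorem injOn_pairFreq : Set.InjOn pairFreq pairRegion := by
  rintro ⟨a, b⟩ ⟨hab, hab0⟩ ⟨c, d⟩ ⟨hcd, hcd0⟩ h
  have hpi : -(2 * Real.pi)⁻¹ ≠ 0 := by have := Real.pi_pos; simp [this.ne']
  obtain ⟨h1, h2⟩ := Prod.ext_iff.1 h
  have h1 : a ^ 3 + b ^ 3 = c ^ 3 + d ^ 3 := mul_left_cancel₀ hpi h1
  have h2 : a + b = c + d := mul_left_cancel₀ hpi h2
  dsimp only at hab hab0 hcd hcd0
  have h3 : a * b = c * d := by
    refine mul_left_cancel₀ hab0 ?_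
    have hd : d = a + b - c := by linarith
    subst hd
    linear_combination (-1 / 3 : ℝ) * h1
  have h4 : (c - a) * (c - b) = 0 := by linear_combination c * h2.symm - h3.symm
  rcases mul_eq_zero.1 h4 with h5 | h5
  · have : c = a := by linarith
    have : d = b := by linarith
    simp [*]
  · exfalso; linarith

/-- The Hausdorff–Young inequality after the change of variables `pairFreq`. -/
theorem lintegral_enorm_pair_cube_le {G : ℝ × ℝ → ℂ} (hG : IntegrableOn G pairRegion) :
    ∫⁻ z : ℝ × ℝ, ‖∫ q in pairRegion, wavePhase z q.1 * wavePhase z q.2 * G q‖ₑ ^ (3 : ℝ) ≤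
      24 * (∫⁻ q in pairRegion, ‖G q‖ₑ ^ (3 / 2 : ℝ) *
        ENNReal.ofReal (|(fderivPairFreq q).det| ^ (-1 / 2 : ℝ))) ^ 2 := by
  set J : ℝ × ℝ → ℝ := fun q => |(fderivPairFreq q).det| with hJ
  set inv := Function.invFunOn pairFreq pairRegion with hinv
  set D := pairFreq '' pairRegion with hD
  have hinv_apply : ∀ q ∈ pairRegion, inv (pairFreq q) = q := fun q hq =>
    injOn_pairFreq.leftInvOn_invFunOn hq
  have hder : ∀ q ∈ pairRegion, HasFDerivWithinAt pairFreq (fderivPairFreq q) pairRegion q :=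
    fun q _ => (hasFDerivAt_pairFreq q).hasFDerivWithinAt
  have hDm : MeasurableSet D :=
    measurable_image_of_fderivWithin measurableSet_pairRegion hder injOn_pairFreq
  -- the density, with respect to the space-time frequency, of the pushforward of `G` by `pairFreq`
  set H : ℝ × ℝ → ℂ := fun y => (J (inv y))⁻¹ • G (inv y) with hH
  have hHint : IntegrableOn H D := by
    rw [hD, integrableOn_image_iff_integrableOn_abs_det_fderiv_smul volume
      measurableSet_pairRegion hder injOn_pairFreq]
    refine hG.congr_fun (fun q hq => ?_) measurableSet_pairRegion
    simp only [hH, hinv_apply q hq, smul_smul]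
    rw [mul_inv_cancel₀ (abs_det_fderivPairFreq_pos hq).ne', one_smul]
  have key := lintegral_enorm_fourier_prod_cube_le (hHint.integrable_indicator hDm)
  have hL : ∀ z : ℝ × ℝ, ∫ y : ℝ × ℝ, Complex.exp
      (((-2 * Real.pi * (y.1 * z.1 + y.2 * z.2) : ℝ) : ℂ) * Complex.I) * D.indicator H y =
      ∫ q in pairRegion, wavePhase z q.1 * wavePhase z q.2 * G q := by
    intro z
    have : ∀ y : ℝ × ℝ, Complex.exp
        (((-2 * Real.pi * (y.1 * z.1 + y.2 * z.2) : ℝ) : ℂ) * Complex.I) * D.indicator H y =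
        D.indicator (fun y => Complex.exp
        (((-2 * Real.pi * (y.1 * z.1 + y.2 * z.2) : ℝ) : ℂ) * Complex.I) * H y) y := by
      intro y
      by_cases hy : y ∈ D <;> simp [hy]
    simp_rw [this]
    rw [integral_indicator hDm, hD, integral_image_eq_integral_abs_det_fderiv_smul volume
      measurableSet_pairRegion hder injOn_pairFreq]
    refine setIntegral_congr_fun measurableSet_pairRegion fun q hq => ?_
    simp only [hH, hinv_apply q hq, Complex.real_smul]
    have hJ0 : (J q : ℂ) ≠ 0 := by
      exact_mod_cast (abs_det_fderivPairFreq_pos hq).ne'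
    have hphase : Complex.exp (((-2 * Real.pi * ((pairFreq q).1 * z.1 + (pairFreq q).2 * z.2) : ℝ) :
        ℂ) * Complex.I) = wavePhase z q.1 * wavePhase z q.2 := by
      rw [wavePhase, wavePhase, ← Complex.exp_add, ← add_mul, ← Complex.ofReal_add]
      congr 3
      simp only [pairFreq]
      have := Real.pi_pos.ne'
      field_simp
      ring
    rw [hphase, Complex.ofReal_inv]
    change (J q : ℂ) * _ = _
    field_simp
  have hR : ∫⁻ y, ‖D.indicator H y‖ₑ ^ (3 / 2 : ℝ) = ∫⁻ q in pairRegion, ‖G q‖ₑ ^ (3 / 2 : ℝ) *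
        ENNReal.ofReal (|(fderivPairFreq q).det| ^ (-1 / 2 : ℝ)) := by
    have : ∀ y, ‖D.indicator H y‖ₑ ^ (3 / 2 : ℝ) =
        D.indicator (fun y => ‖H y‖ₑ ^ (3 / 2 : ℝ)) y := by
      intro y
      by_cases hy : y ∈ D <;> simp [hy]
    simp_rw [this]
    rw [lintegral_indicator hDm, hD, lintegral_image_eq_lintegral_abs_det_fderiv_mul volume
      measurableSet_pairRegion hder injOn_pairFreq]
    refine setLIntegral_congr_fun measurableSet_pairRegion fun q hq => ?_
    have hJ0 : 0 < J q := abs_det_fderivPairFreq_pos hq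
    simp only [hH, hinv_apply q hq]
    change ENNReal.ofReal (J q) * _ = _ * ENNReal.ofReal (J q ^ _)
    rw [enorm_smul, ENNReal.mul_rpow_of_nonneg _ _ (by norm_num), ← ofReal_norm ((J q)⁻¹),
      Real.norm_of_nonneg (by positivity), ENNReal.ofReal_rpow_of_pos (by positivity), ← mul_assoc,
      ← ENNReal.ofReal_mul hJ0.le, mul_comm]
    congr 2
    rw [Real.inv_rpow hJ0.le, ← Real.rpow_neg hJ0.le]
    nth_rewrite 1 [← Real.rpow_one (J q)]
    rw [← Real.rpow_add hJ0]
    norm_num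
  simp_rw [hL, hR] at key
  exact key

theorem ae_mem_pairRegion_or_swap :
    ∀ᵐ q : ℝ × ℝ, (q ∈ pairRegion ∨ q.swap ∈ pairRegion) := by
  have h : ∀ᵐ q : ℝ × ℝ, q.1 - q.2 ≠ 0 ∧ q.1 + q.2 ≠ 0 := by
    have key : ∀ᵐ x : ℝ, ∀ᵐ y : ℝ, x - y ≠ 0 ∧ x + y ≠ 0 := by
      refine Filter.Eventually.of_forall fun x => ?_
      filter_upwards [Measure.ae_ne volume x, Measure.ae_ne volume (-x)] with y h1 h2
      exact ⟨fun h => h1 (by linarith), fun h => h2 (by linarith)⟩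
    refine (Measure.ae_prod_iff_ae_ae ?_).2 key
    exact ((measurableSet_eq_fun (by fun_prop) measurable_const).compl).inter
      ((measurableSet_eq_fun (by fun_prop) measurable_const).compl)
  filter_upwards [h] with q hq
  rcases lt_trichotomy q.1 q.2 with h | h | h
  · exact Or.inl ⟨h, hq.2⟩
  · exact absurd (sub_eq_zero.2 h) hq.1
  · exact Or.inr ⟨h, by simpa [add_comm] using hq.2⟩

/-- The square of a superposition of waves is an integral over pairs of frequencies, and by symmetry
over half of them. -/
theorem integral_wavePhase_sq {h : ℝ → ℂ} (hh : Integrable h) (z : ℝ × ℝ) :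
    (∫ ξ, wavePhase z ξ * h ξ) ^ 2 =
      2 * ∫ q in pairRegion, wavePhase z q.1 * wavePhase z q.2 * (h q.1 * h q.2) := by
  set K : ℝ × ℝ → ℂ := fun q => wavePhase z q.1 * wavePhase z q.2 * (h q.1 * h q.2) with hK
  have hKint : Integrable K := by
    have := (integrable_wavePhase_mul hh z).mul_prod (integrable_wavePhase_mul hh z)
    refine this.congr (Filter.Eventually.of_forall fun q => ?_)
    simp only [hK]
    ring
  have hswapm : MeasurableSet (Prod.swap ⁻¹' pairRegion) :=
    measurable_swap measurableSet_pairRegion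
  have hdisj : Disjoint pairRegion (Prod.swap ⁻¹' pairRegion) :=
    Set.disjoint_left.2 fun q h1 h2 => lt_asymm h1.1 h2.1
  have hswap : ∫ q in Prod.swap ⁻¹' pairRegion, K q = ∫ q in pairRegion, K q := by
    have hmp : MeasurePreserving (Prod.swap : ℝ × ℝ → ℝ × ℝ) volume volume :=
      Measure.measurePreserving_swap
    rw [← hmp.setIntegral_preimage_emb MeasurableEquiv.prodComm.measurableEmbedding K pairRegion]
    refine setIntegral_congr_fun hswapm fun q _ => ?_
    simp only [hK, Prod.fst_swap, Prod.snd_swap]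
    ring
  calc (∫ ξ, wavePhase z ξ * h ξ) ^ 2
      = ∫ q : ℝ × ℝ, (wavePhase z q.1 * h q.1) * (wavePhase z q.2 * h q.2) := by
        rw [sq]
        exact (integral_prod_mul (μ := volume) (ν := volume) _ _).symm
    _ = ∫ q, K q := by
        refine integral_congr_ae (Filter.Eventually.of_forall fun q => ?_)
        simp only [hK]
        ring
    _ = ∫ q in pairRegion ∪ Prod.swap ⁻¹' pairRegion, K q := by
        rw [← setIntegral_univ]
        refine setIntegral_congr_set ?_
        filter_upwards [ae_mem_pairRegion_or_swap] with q hq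
        exact propext ⟨fun _ => hq, fun _ => trivial⟩
    _ = 2 * ∫ q in pairRegion, K q := by
        rw [setIntegral_union hdisj hswapm hKint.integrableOn hKint.integrableOn, hswap, two_mul]

/-- The function `D^{1/6} e^{-t ∂ₓ³} u (x)` of `(t, x)`, when `v = û` is integrable against
`|ξ|^{1/6}`. -/
noncomputable def wave (v : ℝ → ℂ) (z : ℝ × ℝ) : ℂ :=
  (2 * Real.pi : ℂ)⁻¹ * ∫ ξ, wavePhase z ξ * ((|ξ| ^ (1 / 6 : ℝ) : ℝ) * v ξ)

/-- The derivative `D^{1/6}`, distributed over the two factors, is compensated by the Jacobian. -/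
theorem rpow_mul_rpow_mul_det_rpow_le {q : ℝ × ℝ} (hq : q ∈ pairRegion) :
    (|q.1| ^ (1 / 6 : ℝ)) ^ (3 / 2 : ℝ) * (|q.2| ^ (1 / 6 : ℝ)) ^ (3 / 2 : ℝ) *
      |(fderivPairFreq q).det| ^ (-1 / 2 : ℝ) ≤
      2 * Real.pi * |(|q.1| - |q.2|)| ^ (-1 / 2 : ℝ) := by
  have hJ := abs_det_fderivPairFreq_pos hq
  have hpi := Real.pi_pos
  set a := |q.1| with ha
  set b := |q.2| with hb
  have ha0 : 0 ≤ a := abs_nonneg _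
  have hb0 : 0 ≤ b := abs_nonneg _
  have hdet : |(fderivPairFreq q).det| = ((2 * Real.pi)⁻¹) ^ 2 * 3 * ((a + b) * |a - b|) := by
    rw [det_fderivPairFreq, ← sq_abs q.1, ← sq_abs q.2, ← ha, ← hb,
      show a ^ 2 - b ^ 2 = (a + b) * (a - b) by ring, abs_mul, abs_mul, abs_mul,
      abs_of_nonneg (show 0 ≤ ((2 * Real.pi)⁻¹) ^ 2 by positivity),
      abs_of_nonneg (show 0 ≤ a + b by positivity), abs_of_pos (show (0 : ℝ) < 3 by norm_num)]
    ring
  have hpos : 0 < (a + b) * |a - b| := by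
    rw [hdet] at hJ
    exact pos_of_mul_pos_right hJ (by positivity)
  have hab : 0 < a + b := pos_of_mul_pos_left hpos (abs_nonneg _)
  have hd : 0 < |a - b| := pos_of_mul_pos_right hpos hab.le
  have h1 : (a ^ (1 / 6 : ℝ)) ^ (3 / 2 : ℝ) * (b ^ (1 / 6 : ℝ)) ^ (3 / 2 : ℝ) ≤
      (a + b) ^ (1 / 2 : ℝ) := by
    rw [← Real.rpow_mul ha0, ← Real.rpow_mul hb0, ← Real.mul_rpow ha0 hb0,
      show (1 / 2 : ℝ) = 2 * (1 / 6 * (3 / 2)) by norm_num, Real.rpow_mul hab.le, Real.rpow_two]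
    refine Real.rpow_le_rpow (by positivity) ?_ (by norm_num)
    nlinarith
  have h2 : (((2 * Real.pi)⁻¹) ^ 2 * 3 : ℝ) ^ (-1 / 2 : ℝ) ≤ 2 * Real.pi := by
    calc (((2 * Real.pi)⁻¹) ^ 2 * 3 : ℝ) ^ (-1 / 2 : ℝ)
        ≤ (((2 * Real.pi)⁻¹) ^ 2 : ℝ) ^ (-1 / 2 : ℝ) := by
          refine Real.rpow_le_rpow_of_nonpos (by positivity) ?_ (by norm_num)
          have : 0 ≤ ((2 * Real.pi)⁻¹) ^ 2 := by positivity
          linarith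
      _ = 2 * Real.pi := by
          rw [← Real.rpow_two, ← Real.rpow_mul (by positivity)]
          norm_num
          rw [Real.rpow_neg_one]
          field_simp
  rw [hdet, Real.mul_rpow (by positivity) hpos.le, Real.mul_rpow hab.le hd.le]
  have h3 : (a + b) ^ (1 / 2 : ℝ) * (a + b) ^ (-1 / 2 : ℝ) = 1 := by
    rw [← Real.rpow_add hab]
    norm_num
  calc _ ≤ (a + b) ^ (1 / 2 : ℝ) *
        (2 * Real.pi * ((a + b) ^ (-1 / 2 : ℝ) * |a - b| ^ (-1 / 2 : ℝ))) := by
        gcongr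
    _ = _ := by linear_combination (2 * Real.pi * |a - b| ^ (-1 / 2 : ℝ)) * h3

/-- The bilinear estimate: the `L⁶` norm of the wave is controlled by a fractional integral of
`|v| ^ (3/2)`. -/
theorem lintegral_enorm_wave_pow_six_le {v : ℝ → ℂ} (hv : Measurable v)
    (hvi : Integrable fun ξ => ((|ξ| ^ (1 / 6 : ℝ) : ℝ) : ℂ) * v ξ) :
    ∫⁻ z, ‖wave v z‖ₑ ^ (6 : ℝ) ≤ 192 * (∫⁻ x, ∫⁻ y, ‖v x‖ₑ ^ (3 / 2 : ℝ) * ‖v y‖ₑ ^ (3 / 2 : ℝ) *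
      rieszKernel (|x| - |y|)) ^ 2 := by
  set h : ℝ → ℂ := fun ξ => ((|ξ| ^ (1 / 6 : ℝ) : ℝ) : ℂ) * v ξ with hh
  set I : ℝ≥0∞ := ∫⁻ x, ∫⁻ y, ‖v x‖ₑ ^ (3 / 2 : ℝ) * ‖v y‖ₑ ^ (3 / 2 : ℝ) *
      rieszKernel (|x| - |y|) with hI
  have hpi := Real.pi_pos
  have hG : Integrable fun q : ℝ × ℝ => h q.1 * h q.2 := hvi.mul_prod hvi
  have hcube := lintegral_enorm_pair_cube_le hG.integrableOn
  have hhen : ∀ ξ, ‖h ξ‖ₑ ^ (3 / 2 : ℝ) =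
      ENNReal.ofReal ((|ξ| ^ (1 / 6 : ℝ)) ^ (3 / 2 : ℝ)) * ‖v ξ‖ₑ ^ (3 / 2 : ℝ) := by
    intro ξ
    rw [hh, enorm_mul, ENNReal.mul_rpow_of_nonneg _ _ (by norm_num), ← ofReal_norm,
      Complex.norm_real, Real.norm_of_nonneg (by positivity),
      ENNReal.ofReal_rpow_of_nonneg (by positivity) (by norm_num)]
  have hdom : ∫⁻ q in pairRegion, ‖h q.1 * h q.2‖ₑ ^ (3 / 2 : ℝ) *
        ENNReal.ofReal (|(fderivPairFreq q).det| ^ (-1 / 2 : ℝ)) ≤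
      ENNReal.ofReal (2 * Real.pi) * I := by
    have hmeas : Measurable fun q : ℝ × ℝ => ‖v q.1‖ₑ ^ (3 / 2 : ℝ) * ‖v q.2‖ₑ ^ (3 / 2 : ℝ) *
        rieszKernel (|q.1| - |q.2|) :=
      (((hv.comp measurable_fst).enorm.pow_const _).mul
        ((hv.comp measurable_snd).enorm.pow_const _)).mul
        (measurable_rieszKernel.comp (by fun_prop))
    have hI' : I = ∫⁻ q : ℝ × ℝ, ‖v q.1‖ₑ ^ (3 / 2 : ℝ) * ‖v q.2‖ₑ ^ (3 / 2 : ℝ) *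
        rieszKernel (|q.1| - |q.2|) :=
      (lintegral_prod (μ := volume) (ν := volume) _ hmeas.aemeasurable).symm
    rw [hI', ← lintegral_const_mul' _ _ ENNReal.ofReal_ne_top]
    refine (setLIntegral_mono' measurableSet_pairRegion fun q hq => ?_).trans
      (setLIntegral_le_lintegral _ _)
    rw [enorm_mul, ENNReal.mul_rpow_of_nonneg _ _ (by norm_num), hhen, hhen]
    have := ENNReal.ofReal_le_ofReal (rpow_mul_rpow_mul_det_rpow_le hq)
    rw [ENNReal.ofReal_mul (by positivity), ENNReal.ofReal_mul (by positivity),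
      ENNReal.ofReal_mul (by positivity)] at this
    calc _ = ‖v q.1‖ₑ ^ (3 / 2 : ℝ) * ‖v q.2‖ₑ ^ (3 / 2 : ℝ) *
          (ENNReal.ofReal ((|q.1| ^ (1 / 6 : ℝ)) ^ (3 / 2 : ℝ)) *
          ENNReal.ofReal ((|q.2| ^ (1 / 6 : ℝ)) ^ (3 / 2 : ℝ)) *
          ENNReal.ofReal (|(fderivPairFreq q).det| ^ (-1 / 2 : ℝ))) := by ring
      _ ≤ ‖v q.1‖ₑ ^ (3 / 2 : ℝ) * ‖v q.2‖ₑ ^ (3 / 2 : ℝ) * (ENNReal.ofReal (2 * Real.pi) *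
          ENNReal.ofReal (|(|q.1| - |q.2|)| ^ (-1 / 2 : ℝ))) := mul_le_mul_right this _
      _ = _ := by
          rw [rieszKernel]
          ring
  have hpt : ∀ z, ‖wave v z‖ₑ ^ (6 : ℝ) = ENNReal.ofReal (8 * ((2 * Real.pi)⁻¹) ^ 6) *
      ‖∫ q in pairRegion, wavePhase z q.1 * wavePhase z q.2 * (h q.1 * h q.2)‖ₑ ^ (3 : ℝ) := by
    intro z
    have hsq : wave v z ^ 2 = ((2 * ((2 * Real.pi)⁻¹) ^ 2 : ℝ) : ℂ) *
        ∫ q in pairRegion, wavePhase z q.1 * wavePhase z q.2 * (h q.1 * h q.2) := by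
      rw [wave, mul_pow, integral_wavePhase_sq hvi]
      push_cast
      ring
    rw [show (6 : ℝ) = 2 * 3 by norm_num, ENNReal.rpow_mul, ENNReal.rpow_two, ← enorm_pow, hsq,
      enorm_mul, ENNReal.mul_rpow_of_nonneg _ _ (by norm_num), ← ofReal_norm, Complex.norm_real,
      Real.norm_of_nonneg (by positivity),
      ENNReal.ofReal_rpow_of_nonneg (by positivity) (by norm_num)]
    congr 2
    norm_cast
    ring
  simp_rw [hpt]
  rw [lintegral_const_mul' _ _ ENNReal.ofReal_ne_top]
  calc _ ≤ ENNReal.ofReal (8 * ((2 * Real.pi)⁻¹) ^ 6) *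
        (24 * (ENNReal.ofReal (2 * Real.pi) * I) ^ 2) := by
        refine mul_le_mul_right (hcube.trans ?_) _
        gcongr
    _ = ENNReal.ofReal (192 * ((2 * Real.pi)⁻¹) ^ 4) * I ^ 2 := by
        rw [mul_pow, ← ENNReal.ofReal_pow (by positivity), ← mul_assoc, ← mul_assoc]
        congr 1
        rw [show (24 : ℝ≥0∞) = ENNReal.ofReal 24 by norm_num, ← ENNReal.ofReal_mul (by positivity),
          ← ENNReal.ofReal_mul (by positivity)]
        congr 1
        field_simp
        norm_num
    _ ≤ 192 * I ^ 2 := by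
        refine mul_le_mul_left ?_ _
        rw [show (192 : ℝ≥0∞) = ENNReal.ofReal 192 by norm_num]
        refine ENNReal.ofReal_le_ofReal ?_
        have h1 : (2 * Real.pi)⁻¹ ≤ 1 := inv_le_one_of_one_le₀ (by linarith [Real.pi_gt_three])
        have : ((2 * Real.pi)⁻¹) ^ 4 ≤ 1 := pow_le_one₀ (by positivity) h1
        linarith

/-! ### Morrey-type norms and the estimate for nice data -/

/-- The Morrey-type norm `sup_τ |τ|^{1/2 - 1/p} ‖f‖_{L^p(τ)}` of a function on the line;
`intervalSup p u` is its value at `hat u`. -/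
noncomputable def morreySup (p : ℝ) (f : ℝ → ℂ) : ℝ≥0∞ :=
  ⨆ (a : ℝ) (b : ℝ) (_ : a < b),
    ENNReal.ofReal ((b - a) ^ (1 / 2 - 1 / p : ℝ)) *
      eLpNorm f (ENNReal.ofReal p) (volume.restrict (Set.Icc a b))

theorem intervalSup_eq_morreySup (p : ℝ) (u : L2) : intervalSup p u = morreySup p (hat u) := rfl

theorem le_morreySup (p : ℝ) (f : ℝ → ℂ) {a b : ℝ} (hab : a < b) :
    ENNReal.ofReal ((b - a) ^ (1 / 2 - 1 / p : ℝ)) *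
      eLpNorm f (ENNReal.ofReal p) (volume.restrict (Set.Icc a b)) ≤ morreySup p f :=
  le_iSup_of_le a (le_iSup_of_le b (le_iSup_of_le hab le_rfl))

theorem morreySup_mono {p : ℝ} {f g : ℝ → ℂ} (h : ∀ x, ‖f x‖ ≤ ‖g x‖) :
    morreySup p f ≤ morreySup p g := by
  unfold morreySup
  gcongr
  exact eLpNorm_mono h

/-- By Hölder's inequality the Morrey-type norms increase with the exponent. -/
theorem morreySup_mono_exponent {p q : ℝ} (hp : 0 < p) (hpq : p ≤ q) {f : ℝ → ℂ}
    (hf : AEStronglyMeasurable f volume) : morreySup p f ≤ morreySup q f := by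
  refine iSup_le fun a => iSup_le fun b => iSup_le fun hab => ?_
  refine le_trans ?_ (le_morreySup q f hab)
  have hba : 0 < b - a := sub_pos.2 hab
  have h := eLpNorm_le_eLpNorm_mul_rpow_measure_univ (ENNReal.ofReal_le_ofReal hpq)
    (hf.restrict (s := Set.Icc a b))
  rw [Measure.restrict_apply_univ, Real.volume_Icc, ENNReal.toReal_ofReal hp.le,
    ENNReal.toReal_ofReal (hp.le.trans hpq), ENNReal.ofReal_rpow_of_pos hba] at h
  refine (mul_le_mul_right h _).trans (le_of_eq ?_)
  rw [mul_left_comm, ← ENNReal.ofReal_mul (by positivity), ← Real.rpow_add hba, mul_comm]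
  congr 3
  ring

theorem morreySup_le_eLpNorm {p : ℝ} (hp : 0 < p) (hp2 : p ≤ 2) {f : ℝ → ℂ}
    (hf : AEStronglyMeasurable f volume) : morreySup p f ≤ eLpNorm f 2 volume := by
  refine (morreySup_mono_exponent hp hp2 hf).trans ?_
  refine iSup_le fun a => iSup_le fun b => iSup_le fun _ => ?_
  norm_num
  exact eLpNorm_mono_measure f Measure.restrict_le_self

theorem setLIntegral_rpow_le_of_morreySup_le {p S : ℝ} (hp : 0 < p) (hS : 0 ≤ S) {f : ℝ → ℂ}
    (h : morreySup p f ≤ ENNReal.ofReal S) (c : ℝ) {r : ℝ} (hr : 0 < r) :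
    ∫⁻ y in Set.Icc (c - r) (c + r), ‖f y‖ₑ ^ p ≤
      ENNReal.ofReal (S ^ p * (2 * r) ^ (1 - p / 2)) := by
  have h1 := (le_morreySup p f (show c - r < c + r by linarith)).trans h
  rw [show c + r - (c - r) = 2 * r by ring, eLpNorm_eq_lintegral_rpow_enorm_toReal
    (by simpa using hp) ENNReal.ofReal_ne_top, ENNReal.toReal_ofReal hp.le] at h1
  set X := ∫⁻ y in Set.Icc (c - r) (c + r), ‖f y‖ₑ ^ p with hX
  have h2 : X ^ (1 / p) ≤ ENNReal.ofReal (S * (2 * r) ^ (1 / p - 1 / 2)) := by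
    calc X ^ (1 / p) = ENNReal.ofReal ((2 * r) ^ (1 / p - 1 / 2)) *
          (ENNReal.ofReal ((2 * r) ^ (1 / 2 - 1 / p)) * X ^ (1 / p)) := by
          rw [← mul_assoc, ← ENNReal.ofReal_mul (by positivity), ← Real.rpow_add (by positivity)]
          simp
      _ ≤ ENNReal.ofReal ((2 * r) ^ (1 / p - 1 / 2)) * ENNReal.ofReal S := mul_le_mul_right h1 _
      _ = _ := by rw [← ENNReal.ofReal_mul (by positivity), mul_comm]
  have h3 := ENNReal.rpow_le_rpow h2 hp.le
  rw [← ENNReal.rpow_mul, one_div_mul_cancel hp.ne', ENNReal.rpow_one,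
    ENNReal.ofReal_rpow_of_nonneg (by positivity) hp.le,
    Real.mul_rpow hS (by positivity), ← Real.rpow_mul (by positivity)] at h3
  refine h3.trans (le_of_eq ?_)
  congr 3
  field_simp

/-- The constant in the refined Strichartz estimate in terms of `v = û`. -/
noncomputable def strichartzConst (p : ℝ) : ℝ≥0∞ :=
  (192 * ENNReal.ofReal (4 * rieszConst p) ^ 2) ^ (1 / 6 : ℝ)

theorem strichartzConst_ne_top (p : ℝ) : strichartzConst p ≠ ∞ :=
  ENNReal.rpow_ne_top_of_nonneg (by norm_num)
    (ENNReal.mul_ne_top (by norm_num) (ENNReal.pow_ne_top ENNReal.ofReal_ne_top))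

/-- The refined Strichartz estimate for nice `v`. -/
theorem eLpNorm_wave_le {p : ℝ} (hp : 1 < p) (hp' : p ≤ 3 / 2) {v : ℝ → ℂ} (hv : Measurable v)
    (hv2 : MemLp v 2) (hvi : Integrable fun ξ => ((|ξ| ^ (1 / 6 : ℝ) : ℝ) : ℂ) * v ξ) :
    eLpNorm (wave v) 6 volume ≤
      strichartzConst p * morreySup p v ^ (1 / 3 : ℝ) * eLpNorm v 2 volume ^ (2 / 3 : ℝ) := by
  set B : ℝ≥0∞ := ∫⁻ x, ‖v x‖ₑ ^ (2 : ℝ) with hB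
  have hnorm : eLpNorm v 2 volume = B ^ (1 / 2 : ℝ) := by
    rw [eLpNorm_eq_lintegral_rpow_enorm_toReal (by norm_num) (by norm_num)]
    rfl
  have hBtop : B ≠ ∞ := fun h => hv2.2.ne (by rw [hnorm, h]; simp)
  have hMtop : morreySup p v ≠ ∞ :=
    ne_top_of_le_ne_top hv2.2.ne (morreySup_le_eLpNorm (by linarith) (by linarith) hv2.1)
  set I : ℝ≥0∞ := ∫⁻ x, ∫⁻ y, ‖v x‖ₑ ^ (3 / 2 : ℝ) * ‖v y‖ₑ ^ (3 / 2 : ℝ) *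
      rieszKernel (|x| - |y|) with hI
  -- `morreySup p v` may vanish, while the fractional integral estimate needs a positive bound `S`
  have hIε : ∀ ε : ℝ, 0 < ε →
      I ≤ ENNReal.ofReal (4 * rieszConst p) * (morreySup p v + ENNReal.ofReal ε) * B := by
    intro ε hε
    have hS : 0 < (morreySup p v).toReal + ε := by positivity
    have hMS : morreySup p v + ENNReal.ofReal ε = ENNReal.ofReal ((morreySup p v).toReal + ε) := by
      rw [ENNReal.ofReal_add ENNReal.toReal_nonneg hε.le, ENNReal.ofReal_toReal hMtop]
    have := lintegral_lintegral_rieszKernel_le hv.enorm hp hp' hS fun c r hr =>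
      setLIntegral_rpow_le_of_morreySup_le (by linarith) hS.le (hMS ▸ le_self_add) c hr
    rwa [ENNReal.ofReal_mul (mul_nonneg (by norm_num) (rieszConst_pos hp).le), ← hMS] at this
  have hIle : I ≤ ENNReal.ofReal (4 * rieszConst p) * morreySup p v * B := by
    have hlim : Filter.Tendsto (fun ε : ℝ => ENNReal.ofReal (4 * rieszConst p) *
        (morreySup p v + ENNReal.ofReal ε) * B) (nhdsWithin 0 (Set.Ioi 0))
        (nhds (ENNReal.ofReal (4 * rieszConst p) * (morreySup p v + ENNReal.ofReal 0) * B)) := by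
      refine ENNReal.Tendsto.mul_const (ENNReal.Tendsto.const_mul ?_ (Or.inr ENNReal.ofReal_ne_top))
        (Or.inr hBtop)
      refine Filter.Tendsto.mono_left ?_ nhdsWithin_le_nhds
      exact tendsto_const_nhds.add (ENNReal.continuous_ofReal.tendsto 0)
    rw [ENNReal.ofReal_zero, add_zero] at hlim
    exact ge_of_tendsto hlim (eventually_mem_nhdsWithin.mono fun ε hε => hIε ε hε)
  have h6 := (lintegral_enorm_wave_pow_six_le hv hvi).trans
    (mul_le_mul_right (pow_le_pow_left₀ zero_le hIle 2) 192)
  rw [eLpNorm_eq_lintegral_rpow_enorm_toReal (by norm_num) (by norm_num), hnorm]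
  refine (ENNReal.rpow_le_rpow h6 (by norm_num)).trans (le_of_eq ?_)
  rw [strichartzConst, mul_pow, mul_pow, ← mul_assoc, ← mul_assoc,
    ENNReal.mul_rpow_of_nonneg _ _ (by norm_num), ENNReal.mul_rpow_of_nonneg _ _ (by norm_num),
    ← ENNReal.rpow_natCast (morreySup p v), ← ENNReal.rpow_natCast B, ← ENNReal.rpow_mul,
    ← ENNReal.rpow_mul, ← ENNReal.rpow_mul]
  norm_num

theorem eLpNorm_wave_le_eLpNorm {p : ℝ} (hp : 1 < p) (hp' : p ≤ 3 / 2) {v : ℝ → ℂ}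
    (hv : Measurable v) (hv2 : MemLp v 2)
    (hvi : Integrable fun ξ => ((|ξ| ^ (1 / 6 : ℝ) : ℝ) : ℂ) * v ξ) :
    eLpNorm (wave v) 6 volume ≤ strichartzConst p * eLpNorm v 2 volume := by
  refine (eLpNorm_wave_le hp hp' hv hv2 hvi).trans ?_
  rw [mul_assoc]
  refine mul_le_mul_right ?_ _
  calc _ ≤ eLpNorm v 2 volume ^ (1 / 3 : ℝ) * eLpNorm v 2 volume ^ (2 / 3 : ℝ) := by
        gcongr
        exact morreySup_le_eLpNorm (by linarith) (by linarith) hv2.1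
    _ = eLpNorm v 2 volume := by
        rw [← ENNReal.rpow_add_of_nonneg _ _ (by norm_num) (by norm_num)]
        norm_num

/-! ### The defining property of the fractional derivative -/

theorem schwartzHat_eq (φ : 𝓢(ℝ, ℂ)) (x : ℝ) :
    schwartzHat φ x = (𝓕 φ) (x / (2 * Real.pi)) := by
  rw [SchwartzMap.fourier_coe, Real.fourier_real_eq_integral_exp_smul, schwartzHat]
  refine integral_congr_ae (Filter.Eventually.of_forall fun ξ => ?_)
  simp only [smul_eq_mul]
  congr 2
  have : (Real.pi : ℂ) ≠ 0 := by exact_mod_cast Real.pi_pos.ne'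
  push_cast
  field_simp

theorem memLp_schwartzHat (φ : 𝓢(ℝ, ℂ)) (p : ℝ≥0∞) : MemLp (schwartzHat φ) p := by
  have h2π : (2 * Real.pi)⁻¹ ≠ 0 := by positivity
  have h := (SchwartzMap.memLp (𝓕 φ) p volume)
  have h2 : schwartzHat φ = (𝓕 φ : 𝓢(ℝ, ℂ)) ∘ fun x => (2 * Real.pi)⁻¹ * x := by
    funext x
    rw [schwartzHat_eq, Function.comp_apply, div_eq_inv_mul]
  have hmap : Measure.map (fun x => (2 * Real.pi)⁻¹ * x) volume =
      ENNReal.ofReal |((2 * Real.pi)⁻¹)⁻¹| • (volume : Measure ℝ) :=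
    Real.map_volume_mul_left h2π
  rw [h2]
  refine MemLp.comp_of_map ?_ (by fun_prop)
  rw [hmap]
  exact h.smul_measure ENNReal.ofReal_ne_top

/-- For nice `v`, the function `wave v` has the Fourier transform prescribed in `IsFracDeriv`. -/
theorem integral_wave_mul_schwartzHat {v : ℝ → ℂ}
    (hvi : Integrable fun ξ => ((|ξ| ^ (1 / 6 : ℝ) : ℝ) : ℂ) * v ξ) (t : ℝ) (φ : 𝓢(ℝ, ℂ)) :
    ∫ x, wave v (t, x) * schwartzHat φ x =
      ∫ ξ, ((|ξ| ^ (1 / 6 : ℝ) : ℝ) : ℂ) * (symbol t ξ * v ξ) * φ ξ := by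
  have hpi := Real.pi_pos
  set g : ℝ → ℂ := fun ξ => symbol t ξ * (((|ξ| ^ (1 / 6 : ℝ) : ℝ) : ℂ) * v ξ) with hg
  have hgi : Integrable g := by
    have hc : Continuous (symbol t) := by unfold symbol; fun_prop
    exact hvi.bdd_mul hc.aestronglyMeasurable
      (Filter.Eventually.of_forall fun ξ => (norm_symbol t ξ).le)
  have hwave : ∀ x, wave v (t, x) = (2 * Real.pi : ℂ)⁻¹ * 𝓕 g (-(x / (2 * Real.pi))) := by
    intro x
    rw [wave, Real.fourier_real_eq_integral_exp_smul]
    congr 1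
    refine integral_congr_ae (Filter.Eventually.of_forall fun ξ => ?_)
    simp only [hg, smul_eq_mul, wavePhase, symbol, ← mul_assoc, ← Complex.exp_add]
    congr 3
    have : (Real.pi : ℂ) ≠ 0 := by exact_mod_cast hpi.ne'
    push_cast
    field_simp
    ring
  calc ∫ x, wave v (t, x) * schwartzHat φ x
      = ∫ x, (fun y => (2 * Real.pi : ℂ)⁻¹ * (𝓕 g (-y) * (𝓕 φ) y)) (x / (2 * Real.pi)) := by
        refine integral_congr_ae (Filter.Eventually.of_forall fun x => ?_)
        simp only [hwave, schwartzHat_eq, mul_assoc]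
    _ = ∫ y, 𝓕 g (-y) * (𝓕 φ) y := by
        refine (Measure.integral_comp_div
          (fun y => (2 * Real.pi : ℂ)⁻¹ * (𝓕 g (-y) * (𝓕 φ) y)) (2 * Real.pi)).trans ?_
        rw [integral_const_mul, abs_of_pos (by positivity),
          Complex.real_smul, ← mul_assoc]
        have : (Real.pi : ℂ) ≠ 0 := by exact_mod_cast hpi.ne'
        push_cast
        rw [mul_inv_cancel₀ (by simp [this]), one_mul]
    _ = ∫ y, 𝓕 g y * (𝓕⁻ φ) y := by
        rw [← integral_neg_eq_self]
        refine integral_congr_ae (Filter.Eventually.of_forall fun y => ?_)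
        simp only [neg_neg]
        rw [SchwartzMap.fourierInv_coe, Real.fourierInv_eq_fourier_neg, SchwartzMap.fourier_coe]
    _ = ∫ ξ, g ξ * (𝓕 (𝓕⁻ φ)) ξ := by
        rw [integral_fourier_mul_eq hgi (SchwartzMap.integrable _), SchwartzMap.fourier_coe]
    _ = _ := by
        rw [FourierTransform.fourier_fourierInv_eq]
        refine integral_congr_ae (Filter.Eventually.of_forall fun ξ => ?_)
        simp only [hg]
        ring

theorem memLp_rpow_abs_mul_schwartz (φ : 𝓢(ℝ, ℂ)) :
    MemLp (fun ξ => ((|ξ| ^ (1 / 6 : ℝ) : ℝ) : ℂ) * φ ξ) 2 := by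
  have hm : AEStronglyMeasurable (fun ξ => ((|ξ| ^ (1 / 6 : ℝ) : ℝ) : ℂ) * φ ξ) volume := by
    have : Continuous fun ξ : ℝ => ((|ξ| ^ (1 / 6 : ℝ) : ℝ) : ℂ) :=
      Complex.continuous_ofReal.comp (continuous_abs.rpow_const fun _ => Or.inr (by norm_num))
    exact (this.mul φ.continuous).aestronglyMeasurable
  rw [memLp_two_iff_integrable_sq_norm hm]
  obtain ⟨C, hC⟩ := φ.decay 0 0
  have hC' : ∀ ξ, ‖φ ξ‖ ≤ C := fun ξ => by simpa using hC.2 ξ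
  have hC0 := hC.1
  have hdom : Integrable fun ξ => C * ((‖ξ‖ ^ 0 * ‖φ ξ‖) + ‖ξ‖ ^ 1 * ‖φ ξ‖) :=
    ((φ.integrable_pow_mul volume 0).add (φ.integrable_pow_mul volume 1)).const_mul C
  refine hdom.mono' (hm.norm.pow 2) (Filter.Eventually.of_forall fun ξ => ?_)
  have h1 : (|ξ| ^ (1 / 6 : ℝ)) ^ 2 ≤ 1 + |ξ| := by
    rw [← Real.rpow_natCast, ← Real.rpow_mul (abs_nonneg _)]
    calc |ξ| ^ (1 / 6 * ((2 : ℕ) : ℝ)) ≤ (1 + |ξ|) ^ (1 / 6 * ((2 : ℕ) : ℝ)) :=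
          Real.rpow_le_rpow (abs_nonneg _) (by linarith) (by norm_num)
      _ ≤ (1 + |ξ|) ^ (1 : ℝ) :=
          Real.rpow_le_rpow_of_exponent_le (by linarith [abs_nonneg ξ]) (by norm_num)
      _ = _ := Real.rpow_one _
  rw [Real.norm_of_nonneg (by positivity), norm_mul, Complex.norm_real,
    Real.norm_of_nonneg (by positivity), mul_pow, Real.norm_eq_abs, pow_zero, pow_one, one_mul]
  calc (|ξ| ^ (1 / 6 : ℝ)) ^ 2 * ‖φ ξ‖ ^ 2 ≤ (1 + |ξ|) * (C * ‖φ ξ‖) := by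
        rw [sq ‖φ ξ‖]
        gcongr
        exact hC' ξ
    _ = _ := by ring

/-! ### Passage to general square integrable data -/

theorem lintegral_eLpNorm_slice {f : ℝ × ℝ → ℂ} (hf : AEStronglyMeasurable f volume) :
    ∫⁻ t, eLpNorm (fun x => f (t, x)) 6 volume ^ (6 : ℝ) = eLpNorm f 6 volume ^ (6 : ℝ) := by
  have h : ∀ {X : Type} [MeasureSpace X] (g : X → ℂ),
      eLpNorm g 6 volume ^ (6 : ℝ) = ∫⁻ x, ‖g x‖ₑ ^ (6 : ℝ) := by
    intro X _ g
    rw [eLpNorm_eq_lintegral_rpow_enorm_toReal (by norm_num) (by norm_num), ← ENNReal.rpow_mul]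
    norm_num
  simp_rw [h]
  exact (lintegral_prod (μ := volume) (ν := volume) _ (hf.enorm.pow_const (6 : ℝ))).symm

theorem ae_memLp_slice {f : ℝ × ℝ → ℂ} (hf : MemLp f 6) :
    ∀ᵐ t : ℝ, MemLp (fun x => f (t, x)) 6 := by
  have h1 : ∀ᵐ t : ℝ, AEStronglyMeasurable (fun x => f (t, x)) volume :=
    AEStronglyMeasurable.prodMk_left (μ := volume) (ν := volume) hf.1
  have hm : AEMeasurable (fun t : ℝ => ∫⁻ x, ‖f (t, x)‖ₑ ^ (6 : ℝ)) volume :=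
    AEMeasurable.lintegral_prod_right' (μ := volume) (ν := volume) (hf.1.enorm.pow_const (6 : ℝ))
  have h2 : ∫⁻ t : ℝ, ∫⁻ x, ‖f (t, x)‖ₑ ^ (6 : ℝ) ≠ ∞ := by
    rw [← lintegral_prod (μ := volume) (ν := volume) (fun z => ‖f z‖ₑ ^ (6 : ℝ))
      (hf.1.enorm.pow_const (6 : ℝ))]
    have := lintegral_rpow_enorm_lt_top_of_eLpNorm_lt_top (by norm_num) (by norm_num) hf.2
    exact this.ne
  filter_upwards [h1, ae_lt_top' hm h2] with t ht1 ht2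
  refine ⟨ht1, ?_⟩
  rw [eLpNorm_eq_lintegral_rpow_enorm_toReal (by norm_num) (by norm_num)]
  exact ENNReal.rpow_lt_top_of_nonneg (by norm_num) ht2.ne

/-- Convergence in `L⁶(ℝ × ℝ)` gives, along a subsequence, convergence in `L⁶(ℝ)` of almost every
slice. -/
theorem exists_seq_tendsto_eLpNorm_slice {f : ℕ → ℝ × ℝ → ℂ}
    (hf : ∀ n, AEStronglyMeasurable (f n) volume)
    (h : Filter.Tendsto (fun n => eLpNorm (f n) 6 volume) Filter.atTop (nhds 0)) :
    ∃ ns : ℕ → ℕ, StrictMono ns ∧ ∀ᵐ t : ℝ,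
      Filter.Tendsto (fun k => eLpNorm (fun x => f (ns k) (t, x)) 6 volume) Filter.atTop
        (nhds 0) := by
  have h6 : Filter.Tendsto (fun n => eLpNorm (f n) 6 volume ^ (6 : ℝ)) Filter.atTop (nhds 0) := by
    have := h.ennrpow_const 6
    rwa [ENNReal.zero_rpow_of_pos (by norm_num)] at this
  obtain ⟨ns, hns, hle⟩ := Filter.extraction_forall_of_eventually
    (P := fun k n => eLpNorm (f n) 6 volume ^ (6 : ℝ) ≤ 2⁻¹ ^ k) fun k =>
      h6.eventually_le_const (ENNReal.pow_pos (by norm_num) k)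
  refine ⟨ns, hns, ?_⟩
  have hm : ∀ k, AEMeasurable (fun t : ℝ => ∫⁻ x, ‖f (ns k) (t, x)‖ₑ ^ (6 : ℝ)) volume :=
    fun k => AEMeasurable.lintegral_prod_right' (μ := volume) (ν := volume)
      ((hf (ns k)).enorm.pow_const (6 : ℝ))
  have heq : ∀ k t, eLpNorm (fun x => f (ns k) (t, x)) 6 volume =
      (∫⁻ x, ‖f (ns k) (t, x)‖ₑ ^ (6 : ℝ)) ^ (1 / 6 : ℝ) := fun k t => by
    rw [eLpNorm_eq_lintegral_rpow_enorm_toReal (by norm_num) (by norm_num)]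
    rfl
  have hsum : ∫⁻ t : ℝ, ∑' k, ∫⁻ x, ‖f (ns k) (t, x)‖ₑ ^ (6 : ℝ) ≠ ∞ := by
    rw [lintegral_tsum hm]
    refine ne_top_of_le_ne_top (b := ∑' k : ℕ, (2⁻¹ : ℝ≥0∞) ^ k) ?_
      (ENNReal.tsum_le_tsum fun k => ?_)
    · rw [ENNReal.tsum_geometric]
      norm_num
    · refine le_trans (le_of_eq ?_) (hle k)
      rw [← lintegral_eLpNorm_slice (hf (ns k))]
      refine lintegral_congr fun t => ?_
      rw [heq, ← ENNReal.rpow_mul]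
      norm_num
  filter_upwards [ae_lt_top' (AEMeasurable.tsum hm) hsum] with t ht
  have := (ENNReal.tendsto_atTop_zero_of_tsum_ne_top ht.ne).ennrpow_const (1 / 6)
  rw [ENNReal.zero_rpow_of_pos (by norm_num)] at this
  simp_rw [heq]
  exact this

/-- The restriction of `v` to the frequencies `|ξ| ≤ n`. -/
noncomputable def freqCut (v : ℝ → ℂ) (n : ℕ) : ℝ → ℂ := (Set.Icc (-n : ℝ) n).indicator v

theorem norm_freqCut_le (v : ℝ → ℂ) (n : ℕ) (ξ : ℝ) : ‖freqCut v n ξ‖ ≤ ‖v ξ‖ :=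
  norm_indicator_le_norm_self v ξ

theorem tendsto_freqCut (v : ℝ → ℂ) (ξ : ℝ) :
    Filter.Tendsto (fun n => freqCut v n ξ) Filter.atTop (nhds (v ξ)) := by
  refine tendsto_const_nhds.congr' ?_
  obtain ⟨N, hN⟩ := exists_nat_ge |ξ|
  filter_upwards [Filter.eventually_ge_atTop N] with n hn
  have : |ξ| ≤ n := hN.trans (by exact_mod_cast hn)
  exact (Set.indicator_of_mem (Set.mem_Icc.2 (abs_le.1 this)) v).symm

theorem measurable_freqCut {v : ℝ → ℂ} (hv : Measurable v) (n : ℕ) : Measurable (freqCut v n) :=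
  hv.indicator measurableSet_Icc

theorem memLp_freqCut {v : ℝ → ℂ} (hv2 : MemLp v 2) (n : ℕ) : MemLp (freqCut v n) 2 :=
  hv2.indicator measurableSet_Icc

theorem integrable_rpow_mul_freqCut {v : ℝ → ℂ} (hv2 : MemLp v 2) (n : ℕ) :
    Integrable fun ξ => ((|ξ| ^ (1 / 6 : ℝ) : ℝ) : ℂ) * freqCut v n ξ := by
  have hc : Continuous fun ξ : ℝ => ((|ξ| ^ (1 / 6 : ℝ) : ℝ) : ℂ) :=
    Complex.continuous_ofReal.comp (continuous_abs.rpow_const fun _ => Or.inr (by norm_num))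
  have h1 : IntegrableOn v (Set.Icc (-n : ℝ) n) :=
    (hv2.locallyIntegrable (by norm_num)).integrableOn_isCompact isCompact_Icc
  have h2 := h1.continuousOn_mul hc.continuousOn isCompact_Icc
  refine (h2.integrable_indicator measurableSet_Icc).congr (Filter.Eventually.of_forall fun ξ => ?_)
  simp only [freqCut]
  by_cases h : ξ ∈ Set.Icc (-n : ℝ) n <;> simp [h]

theorem tendsto_eLpNorm_sub_freqCut {v : ℝ → ℂ} (hv : Measurable v) (hv2 : MemLp v 2) :
    Filter.Tendsto (fun n => eLpNorm (v - freqCut v n) 2 volume) Filter.atTop (nhds 0) := by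
  have hfin := lintegral_rpow_enorm_lt_top_of_eLpNorm_lt_top (by norm_num) (by norm_num) hv2.2
  have hlim : Filter.Tendsto (fun n => ∫⁻ ξ, ‖(v - freqCut v n) ξ‖ₑ ^ (2 : ℝ)) Filter.atTop
      (nhds (∫⁻ _ : ℝ, 0)) := by
    refine tendsto_lintegral_of_dominated_convergence (fun ξ => ‖v ξ‖ₑ ^ (2 : ℝ))
      (fun n => ((hv.sub (measurable_freqCut hv n)).enorm).pow_const _) (fun n => ?_) hfin.ne ?_
    · refine Filter.Eventually.of_forall fun ξ => ?_
      refine ENNReal.rpow_le_rpow ?_ (by norm_num)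
      rw [enorm_le_iff_norm_le, Pi.sub_apply, freqCut]
      by_cases h : ξ ∈ Set.Icc (-n : ℝ) n <;> simp [h]
    · refine Filter.Eventually.of_forall fun ξ => ?_
      have h1 : Filter.Tendsto (fun n => (v - freqCut v n) ξ) Filter.atTop (nhds 0) := by
        simpa using (tendsto_const_nhds (x := v ξ)).sub (tendsto_freqCut v ξ)
      have h2 := (h1.enorm).ennrpow_const 2
      simpa using h2
  rw [lintegral_zero] at hlim
  have := hlim.ennrpow_const (1 / 2)
  rw [ENNReal.zero_rpow_of_pos (by norm_num)] at this
  refine this.congr fun n => ?_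
  rw [eLpNorm_eq_lintegral_rpow_enorm_toReal (by norm_num) (by norm_num)]
  rfl

theorem aestronglyMeasurable_wave {v : ℝ → ℂ} (hv : Measurable v) :
    AEStronglyMeasurable (wave v) volume := by
  refine AEStronglyMeasurable.const_mul ?_ _
  have hm : Measurable fun q : (ℝ × ℝ) × ℝ =>
      wavePhase q.1 q.2 * (((|q.2| ^ (1 / 6 : ℝ) : ℝ) : ℂ) * v q.2) :=
    continuous_wavePhase_uncurry.measurable.mul
      ((Complex.measurable_ofReal.comp (by fun_prop)).mul (hv.comp measurable_snd))
  exact hm.stronglyMeasurable.integral_prod_right'.aestronglyMeasurable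

theorem wave_sub {v v' : ℝ → ℂ}
    (hvi : Integrable fun ξ => ((|ξ| ^ (1 / 6 : ℝ) : ℝ) : ℂ) * v ξ)
    (hvi' : Integrable fun ξ => ((|ξ| ^ (1 / 6 : ℝ) : ℝ) : ℂ) * v' ξ) :
    wave (v - v') = wave v - wave v' := by
  funext z
  rw [Pi.sub_apply, wave, wave, wave, ← mul_sub,
    ← integral_sub (integrable_wavePhase_mul hvi z) (integrable_wavePhase_mul hvi' z)]
  simp only [Pi.sub_apply, mul_sub]

/-- A subsequence of the frequency cut-offs whose waves converge in `L⁶`. -/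
theorem exists_tendsto_wave {p : ℝ} (hp : 1 < p) (hp' : p ≤ 3 / 2) {v : ℝ → ℂ} (hv : Measurable v)
    (hv2 : MemLp v 2) :
    ∃ (N : ℕ → ℕ) (w : ℝ × ℝ → ℂ), StrictMono N ∧ MemLp w 6 ∧
      Filter.Tendsto (fun n => eLpNorm (wave (freqCut v (N n)) - w) 6 volume) Filter.atTop
        (nhds 0) := by
  obtain ⟨N, hN, hle⟩ := Filter.extraction_forall_of_eventually
    (P := fun k n => eLpNorm (v - freqCut v n) 2 volume ≤ 2⁻¹ ^ k) fun k =>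
      (tendsto_eLpNorm_sub_freqCut hv hv2).eventually_le_const (ENNReal.pow_pos (by norm_num) k)
  set K := strichartzConst p with hK
  have hmem : ∀ n, MemLp (wave (freqCut v (N n))) 6 := fun n =>
    ⟨aestronglyMeasurable_wave (measurable_freqCut hv _),
      (eLpNorm_wave_le_eLpNorm hp hp' (measurable_freqCut hv _) (memLp_freqCut hv2 _)
        (integrable_rpow_mul_freqCut hv2 _)).trans_lt
        (ENNReal.mul_lt_top (strichartzConst_ne_top p).lt_top (memLp_freqCut hv2 _).2)⟩
  have hgeom : ∑' k : ℕ, (2 * K + 1) * (2⁻¹ : ℝ≥0∞) ^ k ≠ ∞ := by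
    rw [ENNReal.tsum_mul_left, ENNReal.tsum_geometric]
    refine ENNReal.mul_ne_top ?_ (by norm_num)
    exact ENNReal.add_ne_top.2
      ⟨ENNReal.mul_ne_top (by norm_num) (strichartzConst_ne_top p), by norm_num⟩
  have hcauchy : ∀ k n m : ℕ, k ≤ n → k ≤ m →
      eLpNorm (wave (freqCut v (N n)) - wave (freqCut v (N m))) 6 volume <
        (2 * K + 1) * (2⁻¹ : ℝ≥0∞) ^ k := by
    intro k n m hn hm
    have hpow : ∀ {j : ℕ}, k ≤ j → (2⁻¹ : ℝ≥0∞) ^ j ≤ 2⁻¹ ^ k := fun h =>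
      pow_le_pow_of_le_one zero_le (by norm_num) h
    have hdiff : eLpNorm (freqCut v (N n) - freqCut v (N m)) 2 volume ≤ 2 * 2⁻¹ ^ k := by
      have : freqCut v (N n) - freqCut v (N m) =
          (v - freqCut v (N m)) - (v - freqCut v (N n)) := by abel
      rw [this, two_mul]
      refine (eLpNorm_sub_le (hv2.1.sub (memLp_freqCut hv2 _).1)
        (hv2.1.sub (memLp_freqCut hv2 _).1) (by norm_num)).trans ?_
      exact add_le_add ((hle m).trans (hpow hm)) ((hle n).trans (hpow hn))
    rw [← wave_sub (integrable_rpow_mul_freqCut hv2 _) (integrable_rpow_mul_freqCut hv2 _)]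
    have hint : Integrable fun ξ => ((|ξ| ^ (1 / 6 : ℝ) : ℝ) : ℂ) *
        (freqCut v (N n) - freqCut v (N m)) ξ := by
      refine ((integrable_rpow_mul_freqCut hv2 (N n)).sub
        (integrable_rpow_mul_freqCut hv2 (N m))).congr (Filter.Eventually.of_forall fun ξ => ?_)
      simp only [Pi.sub_apply, mul_sub]
    have hb := eLpNorm_wave_le_eLpNorm hp hp' ((measurable_freqCut hv _).sub
      (measurable_freqCut hv _)) ((memLp_freqCut hv2 _).sub (memLp_freqCut hv2 _)) hint
    have h0 : (2⁻¹ : ℝ≥0∞) ^ k ≠ 0 := (ENNReal.pow_pos (by norm_num) k).ne'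
    have htop : (2⁻¹ : ℝ≥0∞) ^ k ≠ ∞ := ENNReal.pow_ne_top (by norm_num)
    refine (hb.trans (mul_le_mul_right hdiff _)).trans_lt ?_
    rw [add_mul, one_mul, ← mul_assoc, mul_comm K 2]
    exact ENNReal.lt_add_right (ENNReal.mul_ne_top (ENNReal.mul_ne_top (by norm_num)
      (strichartzConst_ne_top p)) htop) h0
  obtain ⟨w, hw, hlim⟩ := Lp.cauchy_complete_eLpNorm (by norm_num) hmem hgeom hcauchy
  exact ⟨N, w, hN, hw, hlim⟩

theorem tendsto_integral_freqCut {v : ℝ → ℂ} (hv : Measurable v) (hv2 : MemLp v 2) (t : ℝ)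
    (φ : 𝓢(ℝ, ℂ)) :
    Filter.Tendsto (fun n => ∫ ξ, ((|ξ| ^ (1 / 6 : ℝ) : ℝ) : ℂ) * (symbol t ξ * freqCut v n ξ) *
      φ ξ) Filter.atTop
      (nhds (∫ ξ, ((|ξ| ^ (1 / 6 : ℝ) : ℝ) : ℂ) * (symbol t ξ * v ξ) * φ ξ)) := by
  have hdom := (hv2.integrable_mul (memLp_rpow_abs_mul_schwartz φ)).norm
  have hc : Continuous (symbol t) := by unfold symbol; fun_prop
  refine tendsto_integral_of_dominated_convergence _ (fun n => ?_) hdom (fun n => ?_) ?_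
  · exact (((Complex.measurable_ofReal.comp (by fun_prop)).mul
      (hc.measurable.mul (measurable_freqCut hv n))).mul
      φ.continuous.measurable).aestronglyMeasurable
  · refine Filter.Eventually.of_forall fun ξ => ?_
    simp only [Pi.mul_apply, norm_mul, norm_symbol, one_mul]
    rw [mul_comm (‖((|ξ| ^ (1 / 6 : ℝ) : ℝ) : ℂ)‖), mul_assoc]
    gcongr
    exact norm_freqCut_le v n ξ
  · refine Filter.Eventually.of_forall fun ξ => ?_
    exact ((((tendsto_freqCut v ξ).const_mul (symbol t ξ)).const_mul _).mul_const _)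

/-- The refined Strichartz estimate on the Fourier side, for arbitrary `v ∈ L²`. -/
theorem exists_wave_of_memLp {p : ℝ} (hp : 1 < p) (hp' : p ≤ 3 / 2) {v : ℝ → ℂ}
    (hv : Measurable v) (hv2 : MemLp v 2) :
    ∃ w : ℝ × ℝ → ℂ, AEStronglyMeasurable w volume ∧
      (∀ᵐ t : ℝ, ∀ φ : 𝓢(ℝ, ℂ), Integrable (fun x => w (t, x) * schwartzHat φ x) ∧
        ∫ x, w (t, x) * schwartzHat φ x =
          ∫ ξ, ((|ξ| ^ (1 / 6 : ℝ) : ℝ) : ℂ) * (symbol t ξ * v ξ) * φ ξ) ∧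
      eLpNorm w 6 volume ≤
        strichartzConst p * morreySup p v ^ (1 / 3 : ℝ) * eLpNorm v 2 volume ^ (2 / 3 : ℝ) := by
  obtain ⟨N, w, hN, hw, hlim⟩ := exists_tendsto_wave hp hp' hv hv2
  have hWm : ∀ n, AEStronglyMeasurable (wave (freqCut v n)) volume := fun n =>
    aestronglyMeasurable_wave (measurable_freqCut hv n)
  have hbound : ∀ n, eLpNorm (wave (freqCut v n)) 6 volume ≤
      strichartzConst p * morreySup p v ^ (1 / 3 : ℝ) * eLpNorm v 2 volume ^ (2 / 3 : ℝ) := by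
    intro n
    refine (eLpNorm_wave_le hp hp' (measurable_freqCut hv n) (memLp_freqCut hv2 n)
      (integrable_rpow_mul_freqCut hv2 n)).trans ?_
    gcongr
    · exact morreySup_mono (norm_freqCut_le v n)
    · exact eLpNorm_mono (norm_freqCut_le v n)
  refine ⟨w, hw.1, ?_, ?_⟩
  · obtain ⟨ns, hns, hslice⟩ := exists_seq_tendsto_eLpNorm_slice (fun n => (hWm (N n)).sub hw.1) hlim
    have hWmem : ∀ᵐ t : ℝ, ∀ n, MemLp (fun x => wave (freqCut v n) (t, x)) 6 := by
      refine ae_all_iff.2 fun n => ae_memLp_slice ⟨hWm n, ?_⟩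
      exact (eLpNorm_wave_le_eLpNorm hp hp' (measurable_freqCut hv n) (memLp_freqCut hv2 n)
        (integrable_rpow_mul_freqCut hv2 n)).trans_lt
        (ENNReal.mul_lt_top (strichartzConst_ne_top p).lt_top (memLp_freqCut hv2 n).2)
    filter_upwards [hslice, ae_memLp_slice hw, hWmem] with t ht hwt hWt φ
    -- `φ̂` lies in the dual space `L^{6/5}` of `L⁶`
    have : ENNReal.HolderTriple 6 (6 / 5) 1 := by
      constructor
      rw [inv_one, ENNReal.inv_div (by norm_num) (by norm_num)]
      rw [← one_div, ENNReal.div_add_div_same]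
      norm_num
      exact ENNReal.div_self (by norm_num) (by norm_num)
    have hφ := memLp_schwartzHat φ (6 / 5)
    have hint : ∀ {g : ℝ → ℂ}, MemLp g 6 → Integrable fun x => g x * schwartzHat φ x :=
      fun hg => hφ.integrable_mul hg |>.congr
        (Filter.Eventually.of_forall fun x => mul_comm _ _)
    refine ⟨hint hwt, ?_⟩
    refine tendsto_nhds_unique (f := fun k => ∫ x, wave (freqCut v (N (ns k))) (t, x) *
      schwartzHat φ x) (l := Filter.atTop) ?_ ?_
    · refine tendsto_integral_of_L1 _ (hint hwt).1
        (Filter.Eventually.of_forall fun k => hint (hWt _)) ?_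
      have hup := ENNReal.Tendsto.mul_const (b := eLpNorm (schwartzHat φ) (6 / 5) volume) ht
        (Or.inr hφ.2.ne)
      rw [zero_mul] at hup
      refine tendsto_of_tendsto_of_tendsto_of_le_of_le tendsto_const_nhds hup
        (fun _ => zero_le) fun k => ?_
      have hle := eLpNorm_smul_le_mul_eLpNorm (p := 6) (q := 6 / 5) (r := 1) hφ.1
        ((hWt (N (ns k))).sub hwt).1
      rw [eLpNorm_one_eq_lintegral_enorm] at hle
      refine le_trans (le_of_eq (lintegral_congr fun x => ?_)) hle
      rw [← sub_mul]
      rfl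
    · have h := (tendsto_integral_freqCut hv hv2 t φ).comp (hN.comp hns).tendsto_atTop
      refine h.congr fun k => ?_
      exact (integral_wave_mul_schwartzHat (integrable_rpow_mul_freqCut hv2 _) t φ).symm
  · have htri : ∀ n, eLpNorm w 6 volume ≤
        strichartzConst p * morreySup p v ^ (1 / 3 : ℝ) * eLpNorm v 2 volume ^ (2 / 3 : ℝ) +
          eLpNorm (wave (freqCut v (N n)) - w) 6 volume := by
      intro n
      have : w = wave (freqCut v (N n)) - (wave (freqCut v (N n)) - w) := by abel
      calc eLpNorm w 6 volume
          = eLpNorm (wave (freqCut v (N n)) - (wave (freqCut v (N n)) - w)) 6 volume := by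
            rw [← this]
        _ ≤ _ := (eLpNorm_sub_le (hWm _) ((hWm _).sub hw.1) (by norm_num)).trans
            (add_le_add (hbound _) le_rfl)
    refine ge_of_tendsto' (x := Filter.atTop) ?_ htri
    simpa using (tendsto_const_nhds (x := strichartzConst p * morreySup p v ^ (1 / 3 : ℝ) *
      eLpNorm v 2 volume ^ (2 / 3 : ℝ))).add hlim

theorem map_div_two_pi : Measure.map (fun ξ : ℝ => ξ / (2 * Real.pi)) volume =
    ENNReal.ofReal (2 * Real.pi) • (volume : Measure ℝ) := by
  have h := Real.map_volume_mul_right (a := (2 * Real.pi)⁻¹) (by positivity)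
  rw [inv_inv, abs_of_pos (by positivity)] at h
  simpa only [div_eq_mul_inv] using h

theorem measurable_hat (u : L2) : Measurable (hat u) :=
  (Lp.stronglyMeasurable (𝓕 u : L2)).measurable.comp (by fun_prop)

theorem eLpNorm_hat (u : L2) : eLpNorm (hat u) 2 volume =
    ENNReal.ofReal (2 * Real.pi) ^ (1 / 2 : ℝ) * eLpNorm u 2 volume := by
  have h1 : eLpNorm (hat u) 2 volume =
      eLpNorm (𝓕 u : L2) 2 (Measure.map (fun ξ : ℝ => ξ / (2 * Real.pi)) volume) := by
    rw [eLpNorm_map_measure (Lp.stronglyMeasurable (𝓕 u : L2)).aestronglyMeasurable (by fun_prop)]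
    rfl
  rw [h1, map_div_two_pi, eLpNorm_smul_measure_of_ne_top (by norm_num), ← Lp.enorm_def,
    ← Lp.enorm_def, ← ofReal_norm, ← ofReal_norm u, Lp.norm_fourier_eq]
  norm_num

theorem memLp_hat (u : L2) : MemLp (hat u) 2 :=
  ⟨(measurable_hat u).aestronglyMeasurable, by
    rw [eLpNorm_hat]
    exact ENNReal.mul_lt_top (ENNReal.rpow_lt_top_of_nonneg (by norm_num) ENNReal.ofReal_ne_top)
      (Lp.memLp u).2⟩

theorem hat_evolution_ae_eq (t : ℝ) (u : L2) :
    hat (evolution t u) =ᵐ[volume] fun ξ => symbol t ξ * hat u ξ := by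
  have hq : Measure.QuasiMeasurePreserving (fun ξ : ℝ => ξ / (2 * Real.pi)) volume volume := by
    refine ⟨by fun_prop, ?_⟩
    rw [map_div_two_pi]
    exact Measure.smul_absolutelyContinuous
  have h := hq.ae (memLp_symbol_mul t (𝓕 u)).coeFn_toLp
  filter_upwards [h] with ξ hξ
  rw [hat, evolution, FourierTransform.fourier_fourierInv_eq, hξ, hat]
  congr 2
  field_simp

end Airy

theorem lemma1p3 (p : ℝ) (hp : 1 < p) :
    ∃ C : ℝ≥0, ∀ u₀ : Airy.L2, ∃ w : ℝ × ℝ → ℂ,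
      AEStronglyMeasurable w volume ∧
      (∀ᵐ t : ℝ, Airy.IsFracDeriv (1 / 6) (Airy.evolution t u₀) (fun x => w (t, x))) ∧
      eLpNorm w 6 volume ≤
        (C : ℝ≥0∞) * Airy.intervalSup p u₀ ^ (1 / 3 : ℝ) * eLpNorm u₀ 2 volume ^ (2 / 3 : ℝ) := by
  open Airy in
  -- the splitting by height needs an exponent at most `3/2`; lowering `p` lowers the supremum
  set r : ℝ := min p (3 / 2) with hr
  have hr1 : 1 < r := lt_min hp (by norm_num)
  set K : ℝ≥0∞ := strichartzConst r * (ENNReal.ofReal (2 * Real.pi) ^ (1 / 2 : ℝ)) ^ (2 / 3 : ℝ)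
    with hK
  have hKtop : K ≠ ∞ := ENNReal.mul_ne_top (strichartzConst_ne_top r)
    (ENNReal.rpow_ne_top_of_nonneg (by norm_num)
      (ENNReal.rpow_ne_top_of_nonneg (by norm_num) ENNReal.ofReal_ne_top))
  refine ⟨K.toNNReal, fun u₀ => ?_⟩
  obtain ⟨w, hwm, hwd, hwle⟩ :=
    exists_wave_of_memLp hr1 (min_le_right _ _) (measurable_hat u₀) (memLp_hat u₀)
  refine ⟨w, hwm, ?_, hwle.trans ?_⟩
  · filter_upwards [hwd] with t ht φ
    refine ⟨(ht φ).1, (ht φ).2.trans (integral_congr_ae ?_)⟩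
    filter_upwards [hat_evolution_ae_eq t u₀] with ξ hξ
    rw [hξ]
  · rw [ENNReal.coe_toNNReal hKtop, eLpNorm_hat, ENNReal.mul_rpow_of_nonneg _ _ (by norm_num), hK,
      intervalSup_eq_morreySup]
    have hmono := ENNReal.rpow_le_rpow (morreySup_mono_exponent (by linarith) (min_le_left p (3 / 2))
      (measurable_hat u₀).aestronglyMeasurable) (show (0 : ℝ) ≤ 1 / 3 by norm_num)
    calc _ = strichartzConst r * (ENNReal.ofReal (2 * Real.pi) ^ (1 / 2 : ℝ)) ^ (2 / 3 : ℝ) *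
          morreySup r (hat u₀) ^ (1 / 3 : ℝ) * eLpNorm u₀ 2 volume ^ (2 / 3 : ℝ) := by ring
      _ ≤ _ := by gcongr
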